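/- Let $n\ge 0$ and let $q\in\mathbb{C}$, $q\ne 0$, with $q^{2k}\ne 1$ for $1\le k\le n$. Let $H_n(q)$ be the Hecke algebra over $\mathbb{C}$ with generators $T_1,\dots,T_{n-1}$ and relations $T_iT_{i+1}T_i=T_{i+1}T_iT_{i+1}$, $T_iT_j=T_jT_i$ for $|i-j|>1$, $T_i^2=1+(q-q^{-1})T_i$, and let $y_1=1$, $y_{k+1}=T_k\cdots T_2T_1^2T_2\cdots T_k$ be its Jucys–Murphy elements. For a standard tableau $U$ with $n$ boxes let $c_k=q^{2(b-a)}$ be the quantum content of the box (row $a$, column $b$) containing $k$. (1) For every standard tableau $U$ of shape $\lambda\vdash n$ there is a unique element $E_U\in H_n(q)$ with the following property: there is an irreducible representation of $H_n(q)$ with a basis $v_S$ indexed by the standard tableaux $S$ of shape $\lambda$, such that $y_j v_S=c_j(S)v_S$ for all $j$, in which $E_U$ acts as the projector onto $\mathbb{C}v_U$ along the span of the other $v_S$, while $E_U$ acts by $0$ in every irreducible representation not isomorphic to this one. The element $E_U$ is a primitive idempotent. (2) Put $$T_i(u,v)=T_i+\frac{q-q^{-1}}{v/u-1},\qquad Q_i(u,v;c)=T_i+\frac{q-q^{-1}}{cuv-1},$$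 $$\widetilde Y_j(u_1,\dots,u_j)=Q_{j-1}(u_{j-1},u_j;c)\cdots Q_1(u_1,u_j;c)\;T_1(u_j,u_1)^{-1}\cdots T_{j-1}(u_j,u_{j-1})^{-1},$$ $$\widetilde\Psi_{U}(u_1,\dots,u_n)=\left(\prod_{k=1}^n\frac{u_k-c_k}{cu_kc_k-1}\,\frac{cu_k-1}{u_k-1}\right)\widetilde Y_1(u_1)\,\widetilde Y_2(u_1,u_2)\cdots\widetilde Y_n(u_1,\dots,u_n).$$ Then for every $c\in\mathbb{C}$ with $c\,c_k^2\neq 1$ for $k=1,\dots,n$, the consecutive evaluation of the rational function $\widetilde\Psi_U$ is well defined and $$\widetilde\Psi_{U}(u_1,\dots,u_n)\big|_{u_1=c_1}\big|_{u_2=c_2}\cdots\big|_{u_n=c_n}=E_U .$$ Here, at the $k$-th step, the rational function in $u_k,\dots,u_n$ obtained so far is regular at $u_k=c_k$ for generic $u_{k+1},\dots,u_n$ and is evaluated there. (3) Each $T_i$ is invertible and $Q_i(u,v;0)=T_i^{-1}$. Hence at $c=0$ the function $\widetilde\Psi_U$ becomes the fusion function without parameter $$\left(\prod_{k=1}^n\frac{u_k-c_k}{u_k-1}\right)\prod_{j=1,\dots,n}^{\longrightarrow}\Bigl(T_{j-1}^{-1}\cdots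 T_1^{-1}\;T_1(u_j,u_1)^{-1}\cdots T_{j-1}(u_j,u_{j-1})^{-1}\Bigr),$$ whose consecutive evaluation at $u_1=c_1,\dots,u_n=c_n$ is therefore also equal to $E_U$. -/

import Mathlib

open Polynomial

noncomputable section

/-- Defining relations of the Hecke algebra. The generator with index `i : Fin (n - 1)` is
`T_{i+1}` in the usual one-based numbering. -/
inductive HeckeRel (n : ℕ) (q : ℂ) :
    FreeAlgebra ℂ (Fin (n - 1)) → FreeAlgebra ℂ (Fin (n - 1)) → Prop
  | braid (i j : Fin (n - 1)) (h : j.val = i.val + 1) :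
      HeckeRel n q
        (FreeAlgebra.ι ℂ i * FreeAlgebra.ι ℂ j * FreeAlgebra.ι ℂ i)
        (FreeAlgebra.ι ℂ j * FreeAlgebra.ι ℂ i * FreeAlgebra.ι ℂ j)
  | comm (i j : Fin (n - 1)) (h : i.val + 1 < j.val) :
      HeckeRel n q
        (FreeAlgebra.ι ℂ i * FreeAlgebra.ι ℂ j)
        (FreeAlgebra.ι ℂ j * FreeAlgebra.ι ℂ i)
  | quad (i : Fin (n - 1)) :
      HeckeRel n q
        (FreeAlgebra.ι ℂ i * FreeAlgebra.ι ℂ i)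
        (1 + (q - q⁻¹) • FreeAlgebra.ι ℂ i)

/-- The Hecke algebra `H_n(q)` over `ℂ`, by generators and relations. -/
def HeckeAlgebra (n : ℕ) (q : ℂ) : Type := RingQuot (HeckeRel n q)

instance (n : ℕ) (q : ℂ) : Ring (HeckeAlgebra n q) :=
  inferInstanceAs (Ring (RingQuot (HeckeRel n q)))

instance (n : ℕ) (q : ℂ) : Algebra ℂ (HeckeAlgebra n q) :=
  inferInstanceAs (Algebra ℂ (RingQuot (HeckeRel n q)))

namespace HeckeAlgebra

variable {n : ℕ} (q : ℂ)

/-- The generators. -/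
def T (i : Fin (n - 1)) : HeckeAlgebra n q :=
  RingQuot.mkAlgHom ℂ (HeckeRel n q) (FreeAlgebra.ι ℂ i)

/-- The index of the `k`-th generator among the first `j` ones (zero-based), for `k < j < n`. -/
def genIndex (j : Fin n) (k : Fin j.val) : Fin (n - 1) :=
  ⟨k.val, by have := k.isLt; have := j.isLt; omega⟩

/-- The index of the `k`-th variable (zero-based), for `k < j < n`. -/
def varIndex (j : Fin n) (k : Fin j.val) : Fin n :=
  ⟨k.val, k.isLt.trans j.isLt⟩

/-- The ordered product `f 0 * f 1 * ⋯ * f (j - 1)`. -/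
def ascProd {A : Type*} [Monoid A] {j : ℕ} (f : Fin j → A) : A := (List.ofFn f).prod

/-- The ordered product `f (j - 1) * ⋯ * f 1 * f 0`. -/
def descProd {A : Type*} [Monoid A] {j : ℕ} (f : Fin j → A) : A := (List.ofFn f).reverse.prod

/-- The Jucys--Murphy elements `y_1 = 1`, `y_{k+1} = T_k ⋯ T_2 T_1² T_2 ⋯ T_k`;
the argument `j : Fin n` is the zero-based index. -/
def jucysMurphy (j : Fin n) : HeckeAlgebra n q :=
  descProd (fun k : Fin j.val => T q (genIndex j k)) *
    ascProd (fun k : Fin j.val => T q (genIndex j k))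

/-- The baxterized element `T_i(u, v) = T_i + (q - q⁻¹) / (v / u - 1)`. -/
def baxterT (i : Fin (n - 1)) (u v : ℂ) : HeckeAlgebra n q :=
  T q i + algebraMap ℂ _ ((q - q⁻¹) / (v / u - 1))

/-- The baxterized element `Q_i(u, v; c) = T_i + (q - q⁻¹) / (c u v - 1)`. -/
def baxterQ (i : Fin (n - 1)) (c u v : ℂ) : HeckeAlgebra n q :=
  T q i + algebraMap ℂ _ ((q - q⁻¹) / (c * u * v - 1))

end HeckeAlgebra

/-- A standard tableau of size `n`, recorded as the sequence of boxes (row, column), both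
numbered from `0`, in the order in which they are added: for every `m` the first `m` boxes
form a Young diagram. -/
@[ext] structure StandardTableau (n : ℕ) where
  box : Fin n → ℕ × ℕ
  injective : Function.Injective box
  isLowerSet : ∀ m : ℕ, IsLowerSet {x : ℕ × ℕ | ∃ i : Fin n, i.val < m ∧ box i = x}

namespace StandardTableau

variable {n : ℕ}

/-- The Young diagram formed by the first `m` boxes. -/
def diagram (U : StandardTableau n) (m : ℕ) : YoungDiagram where
  cells := (Finset.univ.filter fun i : Fin n => i.val < m).image U.box
  isLowerSet := by
    have h := U.isLowerSet m
    intro a b hab ha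
    simp only [Finset.coe_image, Finset.coe_filter, Finset.mem_univ, true_and, Set.mem_image,
      Set.mem_ofPred_eq] at ha ⊢
    exact h hab ha

/-- The shape of a standard tableau. -/
def shape (U : StandardTableau n) : YoungDiagram := U.diagram n

/-- The quantum content `q^{2(b-a)}` of the box (row `a`, column `b`) added at step `k`. -/
def quantumContent (q : ℂ) (U : StandardTableau n) (k : Fin n) : ℂ :=
  q ^ (2 * (((U.box k).2 : ℤ) - ((U.box k).1 : ℤ)))

end StandardTableau

/-- Irreducibility of a representation of an algebra. -/
def IsIrreducibleRep {A V : Type*} [Ring A] [Algebra ℂ A] [AddCommGroup V] [Module ℂ V]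
    (ρ : A →ₐ[ℂ] Module.End ℂ V) : Prop :=
  Nontrivial V ∧
    ∀ W : Submodule ℂ V, (∀ a : A, ∀ w ∈ W, ρ a w ∈ W) → W = ⊥ ∨ W = ⊤

/-- Isomorphism of representations of an algebra. -/
def IsoRep {A V W : Type*} [Ring A] [Algebra ℂ A] [AddCommGroup V] [Module ℂ V]
    [AddCommGroup W] [Module ℂ W]
    (ρ : A →ₐ[ℂ] Module.End ℂ V) (σ : A →ₐ[ℂ] Module.End ℂ W) : Prop :=
  ∃ f : V ≃ₗ[ℂ] W, ∀ (a : A) (v : V), f (ρ a v) = σ a (f v)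

/-- The vector space with basis the standard tableaux of shape `lam` and size `n`. -/
abbrev TableauSpace (n : ℕ) (lam : YoungDiagram) : Type :=
  {S : StandardTableau n // S.shape = lam} →₀ ℂ

/-- `ρ` is an irreducible representation of `H_n(q)` corresponding to the diagram `lam`: it is
irreducible and the basis vector `v_S` of each standard tableau `S` of shape `lam` is a common
eigenvector of the Jucys--Murphy elements, the eigenvalues being the quantum contents of `S`. -/
structure IsTableauRep {n : ℕ} (q : ℂ) (lam : YoungDiagram)
    (ρ : HeckeAlgebra n q →ₐ[ℂ] Module.End ℂ (TableauSpace n lam)) : Prop where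
  irreducible : IsIrreducibleRep ρ
  jucysMurphy_apply : ∀ (S : {S : StandardTableau n // S.shape = lam}) (j : Fin n),
    ρ (HeckeAlgebra.jucysMurphy q j) (Finsupp.single S 1) =
      S.1.quantumContent q j • Finsupp.single S 1

/-- `e` is the idempotent `E_U`: in the irreducible representation corresponding to the shape of
`U` it is the projector onto the line of `v_U` along the other basis vectors, and it annihilates
all other irreducible representations. -/
def IsTableauIdempotent {n : ℕ} (q : ℂ) (U : StandardTableau n) (e : HeckeAlgebra n q) : Prop :=
  ∃ ρ : HeckeAlgebra n q →ₐ[ℂ] Module.End ℂ (TableauSpace n U.shape),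
    IsTableauRep q U.shape ρ ∧
    ρ e (Finsupp.single ⟨U, rfl⟩ 1) = Finsupp.single ⟨U, rfl⟩ 1 ∧
    (∀ S : {S : StandardTableau n // S.shape = U.shape}, S.1 ≠ U →
      ρ e (Finsupp.single S 1) = 0) ∧
    ∀ (W : Type) [AddCommGroup W] [Module ℂ W] (σ : HeckeAlgebra n q →ₐ[ℂ] Module.End ℂ W),
      IsIrreducibleRep σ → ¬ IsoRep ρ σ → σ e = 0

/-- Primitive idempotents: nonzero idempotents which are not the sum of two nonzero orthogonal
idempotents. -/
def IsPrimitiveIdempotent {A : Type*} [Ring A] (e : A) : Prop :=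
  IsIdempotentElem e ∧ e ≠ 0 ∧
    ∀ f g : A, IsIdempotentElem f → IsIdempotentElem g → f * g = 0 → g * f = 0 →
      e = f + g → f = 0 ∨ g = 0

/-- `f` coincides, off a finite set, with an `A`-valued rational function `P / d` which is
regular at `a` (`d(a) ≠ 0`), and the value of this rational function at `a` is `x`. -/
def EvaluatesTo {A : Type*} [Ring A] [Algebra ℂ A] (f : ℂ → A) (a : ℂ) (x : A) : Prop :=
  ∃ (P : A[X]) (d : ℂ[X]), d.eval a ≠ 0 ∧
    (∀ᶠ t in Filter.cofinite, d.eval t • f t = P.eval (algebraMap ℂ A t)) ∧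
    d.eval a • x = P.eval (algebraMap ℂ A a)

/-- Consecutive evaluation `F(u_1, …, u_n)|_{u_1 = a_1} ⋯ |_{u_n = a_n} = x` of a rational function:
first evaluate in the first variable at `a_1`, which gives a function `G` of the remaining
variables (determined at all points off the zero set of some nonzero polynomial), then evaluate
`G` consecutively at `a_2, …, a_n`. -/
def ConsecutivelyEvaluatesTo {A : Type*} [Ring A] [Algebra ℂ A] :
    {n : ℕ} → ((Fin n → ℂ) → A) → (Fin n → ℂ) → A → Prop
  | 0, F, a, x => F a = x
  | n + 1, F, a, x => ∃ G : (Fin n → ℂ) → A,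
      (∃ p : MvPolynomial (Fin n) ℂ, p ≠ 0 ∧ ∀ u : Fin n → ℂ, MvPolynomial.eval u p ≠ 0 →
        EvaluatesTo (fun t : ℂ => F (Fin.cons t u)) (a 0) (G u)) ∧
      ConsecutivelyEvaluatesTo G (Fin.tail a) x

namespace HeckeAlgebra

variable {n : ℕ} (q : ℂ)

/-- The element `Ỹ_j(u_1, …, u_j)`, that is,
`Q_{j-1}(u_{j-1}, u_j; c) ⋯ Q_1(u_1, u_j; c) T_1(u_j, u_1)⁻¹ ⋯ T_{j-1}(u_j, u_{j-1})⁻¹`.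
(`Ring.inverse` is the inverse of the factor wherever that is invertible.) -/
def fusionFactor (c : ℂ) (u : Fin n → ℂ) (j : Fin n) : HeckeAlgebra n q :=
  descProd (fun k : Fin j.val => baxterQ q (genIndex j k) c (u (varIndex j k)) (u j)) *
    ascProd (fun k : Fin j.val => Ring.inverse (baxterT q (genIndex j k) (u j) (u (varIndex j k))))

/-- The fusion function `Ψ̃_U(u_1, …, u_n)` with parameter `c`. -/
def fusionFunction (c : ℂ) (U : StandardTableau n) (u : Fin n → ℂ) : HeckeAlgebra n q :=
  (∏ k : Fin n, (u k - U.quantumContent q k) / (c * u k * U.quantumContent q k - 1) *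
      ((c * u k - 1) / (u k - 1))) •
    ascProd (fun j : Fin n => fusionFactor q c u j)

/-- The fusion function without parameter:
the product of the scalars `(u_k - c_k) / (u_k - 1)` and of the elements
`T_{j-1}⁻¹ ⋯ T_1⁻¹ T_1(u_j, u_1)⁻¹ ⋯ T_{j-1}(u_j, u_{j-1})⁻¹`, `j = 1, …, n`. -/
def plainFusionFunction (U : StandardTableau n) (u : Fin n → ℂ) : HeckeAlgebra n q :=
  (∏ k : Fin n, (u k - U.quantumContent q k) / (u k - 1)) •
    ascProd (fun j : Fin n =>
      descProd (fun k : Fin j.val => Ring.inverse (T q (genIndex j k))) *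
        ascProd (fun k : Fin j.val =>
          Ring.inverse (baxterT q (genIndex j k) (u j) (u (varIndex j k)))))

end HeckeAlgebra

end

/-! Everything is read off from Young's seminormal form. On the span of `v_S` and of the vector of
`S` with two consecutive entries exchanged, the corresponding generator acts by a 2×2 block whose
coefficients depend only on the two quantum contents. Contents inside a diagram of `n` boxes differ
by less than `n`, so genericity keeps the denominators nonzero and makes the off-diagonal
coefficient vanish exactly when the exchange destroys standardness. The Hecke relations become
identities between rational functions. The Jucys–Murphy elements are diagonal with the contents as
eigenvalues, and contents separate tableaux (`ext_of_quantumContent`). Hence the product of the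
Lagrange spectral projectors at the contents of `U`, called `tableauIdempotent`, projects onto
`v_U`.

The image of the algebra contains every matrix unit within a shape (`exists_matrixUnit`), so its
dimension is at least the sum of the squares of the numbers of tableaux. That sum is `n!` by a count
in Young's lattice (`sum_countBoxes_insert`), while normal forms of words bound the dimension above
by `n!` (`finrank_le`). The representation on all tableaux is therefore faithful
(`ext_of_totalRep`), and identities may be checked on tableau vectors. Irreducibility, uniqueness of
`E_U` and primitivity follow from the matrix units.

For the fusion formula let `e_k` be the product of the first `k` spectral projectors. Once the first
`k` variables are evaluated and `t` is the next one, `partialIdempotent_mul_partialFactor` gives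
`e_k Ỹ_{k+1}(t) = (t - 1)/(ct - 1) · e_k (c t y_{k+1} - 1)(t - y_{k+1})⁻¹`, by induction from the
exchange relation `baxter_exchange`, itself a consequence of `y_{k+1} = T_k y_k T_k`. Expand over
the eigenvalues `b` of `y_{k+1}` and put `a = c_{k+1}`. The normalised coefficient `(t - a)(ctb - 1)
/ ((cta - 1)(t - b))` is identically `1` for `b = a` and vanishes at `t = a` for `b ≠ a`, because
`ca² ≠ 1`. So each evaluation turns `e_k` into `e_{k+1}`, and the last value is `e_n = E_U`. The
function without parameter is the case `c = 0`. -/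

noncomputable section

/-! ### Contents, genericity and the combinatorics of standard tableaux. -/

/-- The content `b - a` of the box in row `a` and column `b`. -/
def boxContent (x : ℕ × ℕ) : ℤ := (x.2 : ℤ) - (x.1 : ℤ)

/-- The quantum content `q^{2(b-a)}` of the box in row `a` and column `b`. -/
def qContent (q : ℂ) (x : ℕ × ℕ) : ℂ := q ^ (2 * boxContent x)

/-- The boxes `(0, 0), …, (0, x.2)` and `(1, 0), …, (y.1, 0)` form a hook inside `D`. -/
theorem card_add_one_le_of_mem_lowerSet {D : Finset (ℕ × ℕ)} (hD : IsLowerSet (D : Set (ℕ × ℕ)))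
    {x y : ℕ × ℕ} (hx : x ∈ D) (hy : y ∈ D) : x.2 + y.1 + 1 ≤ D.card := by
  have h1 : (Finset.range (x.2 + 1)).image (fun j => ((0 : ℕ), j)) ∪
      (Finset.range y.1).image (fun i => (i + 1, (0 : ℕ))) ⊆ D := by
    intro z hz
    simp only [Finset.mem_union, Finset.mem_image, Finset.mem_range] at hz
    rcases hz with ⟨j, hj, rfl⟩ | ⟨i, hi, rfl⟩
    · exact hD (show ((0 : ℕ), j) ≤ x from ⟨Nat.zero_le _, by simpa using Nat.lt_succ_iff.mp hj⟩) hx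
    · exact hD (show (i + 1, (0 : ℕ)) ≤ y from ⟨by simpa using hi, Nat.zero_le _⟩) hy
  have h2 := Finset.card_le_card h1
  rw [Finset.card_union_of_disjoint, Finset.card_image_of_injective, Finset.card_image_of_injective,
    Finset.card_range, Finset.card_range] at h2
  · omega
  · intro a b h; simpa using h
  · intro a b h; simpa using h
  · rw [Finset.disjoint_left]
    simp only [Finset.mem_image, Finset.mem_range]
    rintro z ⟨j, hj, rfl⟩ ⟨i, hi, h⟩
    simp at h

/-- Even in a lower set of `n + 1` boxes the contents differ by at most `n`, the range covered by
`IsGenericUpTo n`. -/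
theorem abs_boxContent_sub_lt {D : Finset (ℕ × ℕ)} (hD : IsLowerSet (D : Set (ℕ × ℕ)))
    {x y : ℕ × ℕ} (hx : x ∈ D) (hy : y ∈ D) : |boxContent x - boxContent y| < D.card := by
  have h1 := card_add_one_le_of_mem_lowerSet hD hx hy
  have h2 := card_add_one_le_of_mem_lowerSet hD hy hx
  rw [abs_lt, boxContent, boxContent]
  constructor <;> omega

/-- The first `n` powers of `q²` differ from `1`. -/
def IsGenericUpTo (n : ℕ) (q : ℂ) : Prop := ∀ k : ℕ, 1 ≤ k → k ≤ n → q ^ (2 * k) ≠ 1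

theorem IsGenericUpTo.zpow_ne_one {n : ℕ} {q : ℂ} (hq : IsGenericUpTo n q) {d : ℤ} (hd : d ≠ 0)
    (hdn : |d| ≤ n) : q ^ (2 * d) ≠ 1 := by
  rw [Int.abs_eq_natAbs] at hdn
  have h := hq d.natAbs (by omega) (by omega)
  rcases Int.natAbs_eq d with h' | h'
  · intro h1
    apply h
    rw [h'] at h1
    exact_mod_cast h1
  · intro h1
    apply h
    rw [h', mul_neg, zpow_neg, inv_eq_one] at h1
    exact_mod_cast h1

/-- The shift `e = 0` separates contents; `e = 1` detects neighbouring diagonals, where the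
seminormal off-diagonal coefficient vanishes. -/
theorem IsGenericUpTo.qContent_mul_eq {n : ℕ} {q : ℂ} (hq : IsGenericUpTo n q) (hq0 : q ≠ 0)
    {x y : ℕ × ℕ} {e : ℤ} (h : |boxContent x - boxContent y - e| ≤ n)
    (hxy : qContent q x = q ^ (2 * e) * qContent q y) : boxContent x = boxContent y + e := by
  by_contra hne
  refine hq.zpow_ne_one (d := boxContent x - boxContent y - e) (by omega) h ?_
  rw [qContent, qContent, ← zpow_add₀ hq0] at hxy
  have : 2 * (boxContent x - boxContent y - e) =
    2 * boxContent x - (2 * e + 2 * boxContent y) := by ring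
  rw [this, zpow_sub₀ hq0, hxy, div_self (zpow_ne_zero _ hq0)]

theorem IsGenericUpTo.qContent_inj {n : ℕ} {q : ℂ} (hq : IsGenericUpTo n q) (hq0 : q ≠ 0)
    {x y : ℕ × ℕ} (h : |boxContent x - boxContent y| ≤ n)
    (hxy : qContent q x = qContent q y) : boxContent x = boxContent y := by
  have := hq.qContent_mul_eq hq0 (x := x) (y := y) (e := 0) (by simpa using h) (by simpa using hxy)
  simpa using this

/-- The position of the first of the two entries exchanged by the `i`-th simple transposition. -/
def lowIndex {n : ℕ} (i : Fin (n - 1)) : Fin n := ⟨i.val, by have := i.isLt; omega⟩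

/-- The position of the second of the two entries exchanged by the `i`-th simple transposition. -/
def highIndex {n : ℕ} (i : Fin (n - 1)) : Fin n := ⟨i.val + 1, by have := i.isLt; omega⟩

/-- The `i`-th simple transposition. -/
def simpleSwap {n : ℕ} (i : Fin (n - 1)) : Equiv.Perm (Fin n) :=
  Equiv.swap (lowIndex i) (highIndex i)

theorem lowIndex_ne_highIndex {n : ℕ} (i : Fin (n - 1)) : lowIndex i ≠ highIndex i := by
  simp [lowIndex, highIndex]

namespace StandardTableau

variable {n : ℕ}

theorem quantumContent_eq (q : ℂ) (U : StandardTableau n) (k : Fin n) :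
    U.quantumContent q k = qContent q (U.box k) := rfl

theorem exists_box_eq_of_le (U : StandardTableau n) {i : Fin n} {x : ℕ × ℕ} (h : x ≤ U.box i) :
    ∃ k ≤ i, U.box k = x := by
  obtain ⟨k, hk, e⟩ := U.isLowerSet (i.val + 1) h ⟨i, Nat.lt_succ_self _, rfl⟩
  exact ⟨k, Fin.le_def.mpr (by omega), e⟩

theorem le_of_box_le (U : StandardTableau n) {i k : Fin n} (h : U.box k ≤ U.box i) : k ≤ i := by
  obtain ⟨l, hl, e⟩ := U.exists_box_eq_of_le h
  rwa [← U.injective e]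

/-- A standard tableau from a filling in which everything below a box comes before it. -/
def ofBoxes (b : Fin n → ℕ × ℕ) (hb : Function.Injective b)
    (h : ∀ i x, x ≤ b i → ∃ k ≤ i, b k = x) : StandardTableau n where
  box := b
  injective := hb
  isLowerSet := by
    rintro m x y hyx ⟨i, hi, rfl⟩
    obtain ⟨k, hk, e⟩ := h i y hyx
    exact ⟨k, lt_of_le_of_lt hk hi, e⟩

/-- The set of boxes of a standard tableau. -/
def boxes (U : StandardTableau n) : Finset (ℕ × ℕ) := Finset.univ.image U.box

theorem mem_boxes (U : StandardTableau n) {x : ℕ × ℕ} : x ∈ U.boxes ↔ ∃ i, U.box i = x := by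
  simp [boxes]

theorem box_mem_boxes (U : StandardTableau n) (i : Fin n) : U.box i ∈ U.boxes :=
  U.mem_boxes.mpr ⟨i, rfl⟩

theorem isLowerSet_boxes (U : StandardTableau n) : IsLowerSet (U.boxes : Set (ℕ × ℕ)) := by
  intro x y hyx hx
  simp only [Finset.mem_coe, mem_boxes] at hx ⊢
  obtain ⟨i, rfl⟩ := hx
  obtain ⟨k, -, e⟩ := U.exists_box_eq_of_le hyx
  exact ⟨k, e⟩

theorem card_boxes (U : StandardTableau n) : U.boxes.card = n := by
  rw [boxes, Finset.card_image_of_injective _ U.injective, Finset.card_univ, Fintype.card_fin]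

theorem shape_eq_iff {U V : StandardTableau n} : U.shape = V.shape ↔ U.boxes = V.boxes := by
  simp [shape, diagram, YoungDiagram.ext_iff, boxes]

theorem abs_boxContent_sub_lt (U : StandardTableau n) (i j : Fin n) :
    |boxContent (U.box i) - boxContent (U.box j)| < n := by
  have := _root_.abs_boxContent_sub_lt U.isLowerSet_boxes (U.box_mem_boxes i) (U.box_mem_boxes j)
  rwa [U.card_boxes] at this

theorem boxContent_eq_of_qContent_eq {q : ℂ} (hq : IsGenericUpTo n q) (hq0 : q ≠ 0)
    (U : StandardTableau n) {i j : Fin n} (h : qContent q (U.box i) = qContent q (U.box j)) :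
    boxContent (U.box i) = boxContent (U.box j) :=
  hq.qContent_inj hq0 (U.abs_boxContent_sub_lt i j).le h

theorem box_zero (U : StandardTableau n) (i : Fin n) (hi : i.val = 0) : U.box i = (0, 0) := by
  obtain ⟨k, hk, e⟩ := U.exists_box_eq_of_le (show ((0 : ℕ), (0 : ℕ)) ≤ U.box i from
    ⟨Nat.zero_le _, Nat.zero_le _⟩)
  have : k = i := by
    apply Fin.ext
    have := Fin.le_def.mp hk
    omega
  rw [← e, this]

instance : Finite (StandardTableau n) := by
  have : ∀ (U : StandardTableau n) (i : Fin n), (U.box i).1 < n ∧ (U.box i).2 < n := by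
    intro U i
    have := card_add_one_le_of_mem_lowerSet U.isLowerSet_boxes (U.box_mem_boxes i)
      (U.box_mem_boxes i)
    rw [U.card_boxes] at this
    omega
  refine Finite.of_injective (β := Fin n → Fin n × Fin n)
    (fun U i => (⟨_, (this U i).1⟩, ⟨_, (this U i).2⟩)) ?_
  intro U V h
  ext i : 2
  have := congrFun h i
  simp only [Prod.mk.injEq, Fin.mk.injEq] at this
  exact Prod.ext this.1 this.2

instance : Fintype (StandardTableau n) := Fintype.ofFinite _

/-- Exchanging consecutive entries changes the relative order of this pair only, so standardness can
fail only if their boxes are comparable. -/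
theorem exists_box_eq_comp_simpleSwap (S : StandardTableau n) (i : Fin (n - 1))
    (h : ¬ S.box (lowIndex i) ≤ S.box (highIndex i)) :
    ∃ S' : StandardTableau n, S'.box = S.box ∘ simpleSwap i := by
  refine ⟨ofBoxes (S.box ∘ simpleSwap i) (S.injective.comp (Equiv.injective _)) ?_, rfl⟩
  intro j x hx
  obtain ⟨k, hk, rfl⟩ := S.exists_box_eq_of_le hx
  refine ⟨simpleSwap i k, ?_, by simp [simpleSwap]⟩
  have hne : ¬ (k = lowIndex i ∧ simpleSwap i j = highIndex i) := by
    rintro ⟨rfl, h2⟩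
    rw [Function.comp_apply, h2] at hx
    exact h hx
  simp only [simpleSwap, Equiv.swap_apply_def, lowIndex, highIndex, Fin.ext_iff, Fin.le_def] at *
  split_ifs at * <;> simp_all <;> omega

theorem eq_or_eq_of_le_of_le (S : StandardTableau n) (i : Fin (n - 1)) {x : ℕ × ℕ}
    (h1 : S.box (lowIndex i) ≤ x) (h2 : x ≤ S.box (highIndex i)) :
    x = S.box (lowIndex i) ∨ x = S.box (highIndex i) := by
  obtain ⟨k, hk, rfl⟩ := S.exists_box_eq_of_le h2
  have h3 := S.le_of_box_le h1
  simp only [lowIndex, highIndex, Fin.le_def] at h3 hk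
  rcases (show k.val = i.val ∨ k.val = i.val + 1 by omega) with h | h
  · left; congr 1; exact Fin.ext h
  · right; congr 1; exact Fin.ext h

/-- Comparable boxes of consecutive entries are adjacent: otherwise `(a + 1, b)` or `(a, b + 1)`
would lie strictly between them and leave no entry for itself. -/
theorem boxContent_of_le (S : StandardTableau n) (i : Fin (n - 1))
    (h : S.box (lowIndex i) ≤ S.box (highIndex i)) :
    boxContent (S.box (highIndex i)) = boxContent (S.box (lowIndex i)) + 1 ∨
    boxContent (S.box (highIndex i)) = boxContent (S.box (lowIndex i)) + (-1) := by
  have hne : S.box (lowIndex i) ≠ S.box (highIndex i) := fun h' =>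
    lowIndex_ne_highIndex i (S.injective h')
  have key := fun x => S.eq_or_eq_of_le_of_le i (x := x)
  rcases hx : S.box (lowIndex i) with ⟨a, b⟩
  rcases hy : S.box (highIndex i) with ⟨a', b'⟩
  rw [hx, hy] at key h hne
  have h1 := key (a + 1, b)
  have h2 := key (a, b + 1)
  simp only [Prod.mk_le_mk, Prod.mk.injEq, ne_eq, boxContent] at *
  omega

/-- Between incomparable boxes the two coordinates change in opposite directions, each by at least
one. -/
theorem boxContent_of_not_le (S : StandardTableau n) (i : Fin (n - 1))
    (h : ¬ S.box (lowIndex i) ≤ S.box (highIndex i)) :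
    2 ≤ |boxContent (S.box (highIndex i)) - boxContent (S.box (lowIndex i))| := by
  have h' : ¬ S.box (highIndex i) ≤ S.box (lowIndex i) := fun h' => by
    have := S.le_of_box_le h'
    simp only [lowIndex, highIndex, Fin.le_def] at this
    omega
  rcases hx : S.box (lowIndex i) with ⟨a, b⟩
  rcases hy : S.box (highIndex i) with ⟨a', b'⟩
  rw [hx, hy] at h h'
  simp only [Prod.mk_le_mk, boxContent] at *
  rw [le_abs]
  omega

theorem qContent_low_ne_high {q : ℂ} (hq : IsGenericUpTo n q) (hq0 : q ≠ 0)
    (S : StandardTableau n) (i : Fin (n - 1)) :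
    qContent q (S.box (lowIndex i)) ≠ qContent q (S.box (highIndex i)) := by
  intro h
  have h1 := S.boxContent_eq_of_qContent_eq hq hq0 h
  by_cases hle : S.box (lowIndex i) ≤ S.box (highIndex i)
  · have := S.boxContent_of_le i hle
    omega
  · have := S.boxContent_of_not_le i hle
    rw [h1, sub_self, abs_zero] at this
    omega

/-- On a common diagonal both `(a + 1, b)` and `(a, b + 1)` would lie between the two boxes, but
only one entry is available. The braid relation has this difference of contents as a denominator. -/
theorem qContent_first_ne_third {q : ℂ} (hq : IsGenericUpTo n q) (hq0 : q ≠ 0)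
    (S : StandardTableau n) (i j : Fin (n - 1)) (hij : j.val = i.val + 1) :
    qContent q (S.box (lowIndex i)) ≠ qContent q (S.box (highIndex j)) := by
  intro h
  have h1 := S.boxContent_eq_of_qContent_eq hq hq0 h
  have hlt : lowIndex i < highIndex j := by
    simp only [lowIndex, highIndex, Fin.lt_def]; omega
  have hne : S.box (lowIndex i) ≠ S.box (highIndex j) := fun h' => hlt.ne (S.injective h')
  have hnle : ¬ S.box (highIndex j) ≤ S.box (lowIndex i) := fun h' =>
    not_le.mpr hlt (S.le_of_box_le h')
  have key : ∀ x, S.box (lowIndex i) ≤ x → x ≤ S.box (highIndex j) → x = S.box (lowIndex i) ∨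
      x = S.box (highIndex i) ∨ x = S.box (highIndex j) := by
    intro x h1 h2
    obtain ⟨k, hk, rfl⟩ := S.exists_box_eq_of_le h2
    have h3 := S.le_of_box_le h1
    simp only [lowIndex, highIndex, Fin.le_def] at h3 hk
    rcases (show k.val = i.val ∨ k.val = i.val + 1 ∨ k.val = j.val + 1 by omega) with h | h | h
    · left; congr 1; exact Fin.ext h
    · right; left; congr 1; exact Fin.ext h
    · right; right; congr 1; exact Fin.ext h
  rcases hx : S.box (lowIndex i) with ⟨a, b⟩
  rcases hy : S.box (highIndex j) with ⟨a', b'⟩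
  rcases hz : S.box (highIndex i) with ⟨a'', b''⟩
  rw [hx, hy] at hne hnle h1 key
  rw [hz] at key
  have h2 := key (a + 1, b)
  have h3 := key (a, b + 1)
  simp only [Prod.mk_le_mk, Prod.mk.injEq, ne_eq, boxContent] at *
  omega

/-- A tableau is determined by its quantum contents. -/
theorem ext_of_quantumContent {q : ℂ} (hq : IsGenericUpTo n q) (hq0 : q ≠ 0)
    {S U : StandardTableau n} (h : ∀ i, S.quantumContent q i = U.quantumContent q i) : S = U := by
  ext i : 2
  obtain ⟨m, hm⟩ := i
  induction m using Nat.strong_induction_on with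
  | _ m ih =>
    set k : Fin n := ⟨m, hm⟩ with hk
    have ih' : ∀ l : Fin n, l < k → S.box l = U.box l := fun l hl => ih l.val hl l.isLt
    -- the common part together with both new boxes is a lower set
    set D : Finset (ℕ × ℕ) := (Finset.univ.filter (· < k)).image U.box ∪ {S.box k, U.box k} with hD
    have hmem : ∀ x, x ∈ D ↔ (∃ l < k, U.box l = x) ∨ x = S.box k ∨ x = U.box k := by
      intro x; simp only [hD, Finset.mem_union, Finset.mem_image, Finset.mem_filter,
        Finset.mem_univ, true_and, Finset.mem_insert, Finset.mem_singleton]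
    have hlow : IsLowerSet (D : Set (ℕ × ℕ)) := by
      intro x y hyx hx
      rw [Finset.mem_coe, hmem] at hx ⊢
      rcases hx with ⟨l, hl, rfl⟩ | rfl | rfl
      · obtain ⟨p, hp, rfl⟩ := U.exists_box_eq_of_le hyx
        exact Or.inl ⟨p, hp.trans_lt hl, rfl⟩
      · obtain ⟨p, hp, rfl⟩ := S.exists_box_eq_of_le hyx
        rcases hp.lt_or_eq with hp | rfl
        · exact Or.inl ⟨p, hp, (ih' p hp).symm⟩
        · exact Or.inr (Or.inl rfl)
      · obtain ⟨p, hp, rfl⟩ := U.exists_box_eq_of_le hyx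
        rcases hp.lt_or_eq with hp | rfl
        · exact Or.inl ⟨p, hp, rfl⟩
        · exact Or.inr (Or.inr rfl)
    -- At most `m` common boxes and two new ones, with `m < n`; the contents in `D` then differ by
    -- at most `n`, as `qContent_inj` requires.
    have hcard : D.card ≤ n + 1 := by
      refine (Finset.card_union_le _ _).trans ?_
      have h1 : ((Finset.univ.filter (· < k)).image U.box).card ≤ m := by
        refine Finset.card_image_le.trans ?_
        have : (Finset.univ.filter (· < k)) = Finset.Iio k := by ext; simp
        rw [this, Fin.card_Iio]
      have h2 := Finset.card_le_two (a := S.box k) (b := U.box k)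
      omega
    have hS : S.box k ∈ D := (hmem _).2 (Or.inr (Or.inl rfl))
    have hU : U.box k ∈ D := (hmem _).2 (Or.inr (Or.inr rfl))
    have hc := hq.qContent_inj hq0 (x := S.box k) (y := U.box k) (by
      have := _root_.abs_boxContent_sub_lt hlow hS hU
      omega) (h k)
    -- Equal contents put the two boxes on one diagonal, so they are comparable. The smaller one
    -- either carries an earlier entry, against injectivity, or equals the larger.
    have key : ∀ V W : StandardTableau n, (∀ l < k, V.box l = W.box l) →
        boxContent (V.box k) = boxContent (W.box k) → V.box k ≤ W.box k → V.box k = W.box k := by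
      intro V W hVW _ hle
      obtain ⟨p, hp, e⟩ := W.exists_box_eq_of_le hle
      rcases hp.lt_or_eq with hp | rfl
      · rw [← hVW p hp] at e
        exact absurd (V.injective e) hp.ne
      · exact e.symm
    rcases hx : S.box k with ⟨a, b⟩
    rcases hy : U.box k with ⟨a', b'⟩
    have h1 := key S U ih' hc
    have h2 := key U S (fun l hl => (ih' l hl).symm) hc.symm
    rw [hx, hy] at h1 h2 hc
    simp only [Prod.mk_le_mk, Prod.mk.injEq, boxContent] at *
    omega

/-- Tableaux of the same shape are connected by admissible simple transpositions. -/
theorem of_boxes_eq {P : StandardTableau n → Prop}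
    (hP : ∀ (S S' : StandardTableau n) (i : Fin (n - 1)),
      ¬ S.box (lowIndex i) ≤ S.box (highIndex i) → S'.box = S.box ∘ simpleSwap i → P S → P S')
    {S U : StandardTableau n} (h : S.boxes = U.boxes) (hS : P S) : P U := by
  -- Here `k` counts the largest entries that already sit where `U` has them.
  suffices H : ∀ k ≤ n, ∃ S' : StandardTableau n, S'.boxes = U.boxes ∧ P S' ∧
      ∀ i : Fin n, n - k ≤ i.val → S'.box i = U.box i by
    obtain ⟨S', -, h2, h3⟩ := H n le_rfl
    have : S' = U := by
      ext i : 2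
      exact h3 i (by omega)
    rwa [← this]
  intro k
  induction k with
  | zero => exact fun _ => ⟨S, h, hS, fun i hi => by have := i.isLt; omega⟩
  | succ k ih =>
    intro hk
    obtain ⟨S₀, h1, h2, h3⟩ := ih (by omega)
    set m : Fin n := ⟨n - (k + 1), by omega⟩ with hm
    have hsucc : ∀ i : Fin n, m < i → n - k ≤ i.val := by
      intro i hi
      have : m.val < i.val := hi
      simp only [hm] at this
      omega
    -- The entry `p` occupying `U.box m` is raised to `m` one exchange at a time; `d` is the
    -- remaining distance.
    suffices H : ∀ d : ℕ, ∀ S' : StandardTableau n, S'.boxes = U.boxes → P S' →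
        (∀ i : Fin n, n - k ≤ i.val → S'.box i = U.box i) →
        (∃ p : Fin n, p.val + d = m.val ∧ S'.box p = U.box m) →
        ∃ S' : StandardTableau n, S'.boxes = U.boxes ∧ P S' ∧
          ∀ i : Fin n, n - (k + 1) ≤ i.val → S'.box i = U.box i by
      obtain ⟨p, hp⟩ := S₀.mem_boxes.mp (h1 ▸ U.box_mem_boxes m)
      have hpm : p ≤ m := by
        by_contra hlt
        rw [not_le] at hlt
        rw [h3 p (hsucc p hlt)] at hp
        exact hlt.ne' (U.injective hp)
      refine H (m.val - p.val) S₀ h1 h2 h3 ⟨p, ?_, hp⟩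
      have : p.val ≤ m.val := hpm
      omega
    intro d
    induction d with
    | zero =>
      rintro S' h1 h2 h3 ⟨p, hp, hpm⟩
      refine ⟨S', h1, h2, fun i hi => ?_⟩
      by_cases him : i = m
      · have : p = m := Fin.ext (by simpa using hp)
        rw [him, ← hpm, this]
      · refine h3 i (hsucc i ?_)
        rw [Fin.lt_def]
        have : i.val ≠ m.val := fun h => him (Fin.ext h)
        simp only [hm] at *
        omega
    | succ d ihd =>
      rintro S' h1 h2 h3 ⟨p, hp, hpm⟩
      let i : Fin (n - 1) := ⟨p.val, by have := m.isLt; omega⟩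
      have hlow : lowIndex i = p := rfl
      -- Otherwise `U` would place an entry `r ≥ m` in the next box. For `r > m` this entry is
      -- already in place, so it cannot sit at a position at most `m`; for `r = m` two entries would
      -- share a box.
      have hadm : ¬ S'.box (lowIndex i) ≤ S'.box (highIndex i) := by
        intro hle
        obtain ⟨r, hr⟩ := U.mem_boxes.mp (h1 ▸ S'.box_mem_boxes (highIndex i))
        rw [hlow, hpm, ← hr] at hle
        have hmr := U.le_of_box_le hle
        rcases hmr.lt_or_eq with hlt | rfl
        · rw [← h3 r (hsucc r hlt)] at hr
          have := S'.injective hr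
          have h4 : m.val < r.val := hlt
          rw [this] at h4
          simp only [highIndex, i] at h4
          omega
        · rw [← hpm] at hr
          exact lowIndex_ne_highIndex i (S'.injective hr)
      obtain ⟨S'', hS''⟩ := S'.exists_box_eq_comp_simpleSwap i hadm
      refine ihd S'' ?_ (hP S' S'' i hadm hS'' h2) ?_ ?_
      · rw [← h1]
        ext x
        rw [mem_boxes, mem_boxes, hS'']
        exact (simpleSwap i).exists_congr_left.trans (by simp)
      · intro l hl
        rw [← h3 l hl, hS'', Function.comp_apply, simpleSwap, Equiv.swap_apply_of_ne_of_ne]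
        · rintro rfl
          have h4 : (lowIndex i).val = p.val := rfl
          have h5 : m.val = n - (k + 1) := rfl
          omega
        · rintro rfl
          have h4 : (highIndex i).val = p.val + 1 := rfl
          have h5 : m.val = n - (k + 1) := rfl
          omega
      · refine ⟨highIndex i, ?_, ?_⟩
        · simp only [highIndex, i]; omega
        · rw [hS'', Function.comp_apply, simpleSwap, Equiv.swap_apply_right, hlow, hpm]

end StandardTableau

/-! ### Coefficients of the seminormal form. -/

/-- A square root of a complex number. -/
def complexRoot (z : ℂ) : ℂ := (IsAlgClosed.exists_pow_nat_eq z (n := 2) two_pos).choose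

theorem complexRoot_sq (z : ℂ) : complexRoot z ^ 2 = z :=
  (IsAlgClosed.exists_pow_nat_eq z (n := 2) two_pos).choose_spec

/-- The diagonal coefficient of the seminormal form, for entries of quantum contents `c`, `d`. -/
def diagCoeff (q c d : ℂ) : ℂ := (q - q⁻¹) * d / (d - c)

/-- The off-diagonal coefficient of the seminormal form. -/
def offCoeff (q c d : ℂ) : ℂ := complexRoot (1 - (q - q⁻¹) ^ 2 * (c * d) / (d - c) ^ 2)

theorem offCoeff_comm (q c d : ℂ) : offCoeff q c d = offCoeff q d c := by
  rw [offCoeff, offCoeff, mul_comm c d, sub_sq_comm d c]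

theorem offCoeff_sq (q c d : ℂ) :
    offCoeff q c d ^ 2 = 1 - (q - q⁻¹) ^ 2 * (c * d) / (d - c) ^ 2 := complexRoot_sq _

/-- Up to a nonzero factor the square of the coefficient is `(d - q²c)(c - q²d)`. -/
theorem offCoeff_eq_zero_iff {q c d : ℂ} (hq0 : q ≠ 0) (hcd : c ≠ d) :
    offCoeff q c d = 0 ↔ d = q ^ 2 * c ∨ c = q ^ 2 * d := by
  have hdc : d - c ≠ 0 := sub_ne_zero.mpr hcd.symm
  have key : q ^ 2 * (d - c) ^ 2 * offCoeff q c d ^ 2 = -((d - q ^ 2 * c) * (c - q ^ 2 * d)) := by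
    rw [offCoeff_sq]
    field_simp
    ring
  constructor
  · intro h
    rw [h, zero_pow two_ne_zero, mul_zero, zero_eq_neg] at key
    have := key
    rcases mul_eq_zero.mp this with h | h
    · exact Or.inl (sub_eq_zero.mp h)
    · exact Or.inr (sub_eq_zero.mp h)
  · intro h
    have h0 : (d - q ^ 2 * c) * (c - q ^ 2 * d) = 0 := by
      rcases h with h | h
      · rw [sub_eq_zero.mpr h, zero_mul]
      · rw [sub_eq_zero.mpr h, mul_zero]
    rw [h0, neg_zero] at key
    have h1 : q ^ 2 * (d - c) ^ 2 ≠ 0 := mul_ne_zero (pow_ne_zero _ hq0) (pow_ne_zero _ hdc)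
    exact pow_eq_zero_iff two_ne_zero |>.mp ((mul_eq_zero.mp key).resolve_left h1)

/-- Together with `diagCoeff_add_swap` this says that the symmetric 2×2 block has determinant `-1`
and trace `q - q⁻¹`, so that Cayley–Hamilton is the quadratic relation. It dictates the choice of
`offCoeff`. -/
theorem offCoeff_mul_self_add {q c d : ℂ} (hcd : c ≠ d) :
    offCoeff q c d * offCoeff q c d =
      1 + (q - q⁻¹) * diagCoeff q c d - diagCoeff q c d * diagCoeff q c d := by
  have hdc : d - c ≠ 0 := sub_ne_zero.mpr hcd.symm
  rw [← sq, offCoeff_sq, diagCoeff]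
  generalize q - q⁻¹ = δ
  field_simp
  ring

theorem diagCoeff_add_swap {q c d : ℂ} (hcd : c ≠ d) :
    diagCoeff q c d + diagCoeff q d c = q - q⁻¹ := by
  have hdc : d - c ≠ 0 := sub_ne_zero.mpr hcd.symm
  have hcd' : c - d ≠ 0 := sub_ne_zero.mpr hcd
  rw [diagCoeff, diagCoeff]
  generalize q - q⁻¹ = δ
  field_simp
  ring

/-- The braid relation on the six vectors spanned by the orderings of three entries. -/
theorem seminormal_braid {V : Type*} [AddCommGroup V] [Module ℂ V] {q x y z : ℂ}
    (hxy : x ≠ y) (hyz : y ≠ z) (hxz : x ≠ z) (A B : Module.End ℂ V)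
    {v v₁ v₂ v₁₂ v₂₁ w : V}
    (hA : A v = diagCoeff q x y • v + offCoeff q x y • v₁)
    (hA₁ : A v₁ = diagCoeff q y x • v₁ + offCoeff q y x • v)
    (hA₂ : A v₂ = diagCoeff q x z • v₂ + offCoeff q x z • v₂₁)
    (hA₁₂ : A v₁₂ = diagCoeff q y z • v₁₂ + offCoeff q y z • w)
    (hB : B v = diagCoeff q y z • v + offCoeff q y z • v₂)
    (hB₂ : B v₂ = diagCoeff q z y • v₂ + offCoeff q z y • v)
    (hB₁ : B v₁ = diagCoeff q x z • v₁ + offCoeff q x z • v₁₂)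
    (hB₂₁ : B v₂₁ = diagCoeff q x y • v₂₁ + offCoeff q x y • w) :
    A (B (A v)) = B (A (B v)) := by
  have h1 := offCoeff_mul_self_add (q := q) hxy
  have h2 := offCoeff_mul_self_add (q := q) hyz
  rw [offCoeff_comm q y x] at hA₁
  rw [offCoeff_comm q z y] at hB₂
  simp only [hA, hB, map_add, map_smul, hA₁, hA₂, hA₁₂, hB₂, hB₁, hB₂₁, smul_add, smul_smul]
  -- The coefficients of `v`, `v₁`, `v₂` need the three identities `e0`, `e1`, `e2`; those of `v₁₂`,
  -- `v₂₁`, `w` agree by commutativity of scalars.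
  have e0 : diagCoeff q x y * diagCoeff q y z * diagCoeff q x y +
      offCoeff q x y * diagCoeff q x z * offCoeff q x y =
      diagCoeff q y z * diagCoeff q x y * diagCoeff q y z +
      offCoeff q y z * diagCoeff q x z * offCoeff q y z := by
    rw [mul_right_comm (offCoeff q x y), h1, mul_right_comm (offCoeff q y z), h2]
    simp only [diagCoeff]
    generalize q - q⁻¹ = δ
    have := sub_ne_zero.mpr hxy.symm
    have := sub_ne_zero.mpr hyz.symm
    have := sub_ne_zero.mpr hxz.symm
    field_simp
    ring
  have e1 : diagCoeff q x y * diagCoeff q y z + diagCoeff q x z * diagCoeff q y x =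
      diagCoeff q y z * diagCoeff q x z := by
    simp only [diagCoeff]
    generalize q - q⁻¹ = δ
    have := sub_ne_zero.mpr hxy.symm
    have := sub_ne_zero.mpr hxy
    have := sub_ne_zero.mpr hyz.symm
    have := sub_ne_zero.mpr hxz.symm
    field_simp
    ring
  have e2 : diagCoeff q y z * diagCoeff q x y + diagCoeff q x z * diagCoeff q z y =
      diagCoeff q x y * diagCoeff q x z := by
    simp only [diagCoeff]
    generalize q - q⁻¹ = δ
    have := sub_ne_zero.mpr hxy.symm
    have := sub_ne_zero.mpr hyz
    have := sub_ne_zero.mpr hyz.symm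
    have := sub_ne_zero.mpr hxz.symm
    field_simp
    ring
  match_scalars
  · linear_combination e0
  · linear_combination offCoeff q x y * e1
  · linear_combination -offCoeff q y z * e2
  · ring
  · ring
  · ring

/-! ### Seminormal operators on tableaux and the Hecke relations. -/

namespace StandardTableau

variable {n : ℕ}

/-- A class of standard tableaux closed under rearrangements of the entries. -/
def RearrangementClosed (P : StandardTableau n → Prop) : Prop :=
  ∀ (S S' : StandardTableau n) (s : Equiv.Perm (Fin n)), S'.box = S.box ∘ s → P S → P S'

theorem rearrangementClosed_true : RearrangementClosed (fun _ : StandardTableau n => True) :=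
  fun _ _ _ _ _ => trivial

theorem rearrangementClosed_shape (lam : YoungDiagram) :
    RearrangementClosed (fun S : StandardTableau n => S.shape = lam) := by
  rintro S S' s h rfl
  rw [shape_eq_iff]
  ext x
  rw [mem_boxes, mem_boxes, h]
  exact s.exists_congr_left.trans (by simp)

/-- The basis vector of the filling `b` if this is a standard tableau in the class `P`,
and `0` otherwise. -/
def vec (P : StandardTableau n → Prop) (b : Fin n → ℕ × ℕ) : {S // P S} →₀ ℂ := by
  classical exact if h : ∃ S : {S // P S}, S.1.box = b then Finsupp.single h.choose 1 else 0

theorem vec_box {P : StandardTableau n → Prop} (S : {S // P S}) :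
    vec P S.1.box = Finsupp.single S 1 := by
  have h : ∃ S' : {S // P S}, S'.1.box = S.1.box := ⟨S, rfl⟩
  rw [vec, dif_pos h]
  congr 1
  exact Subtype.ext (StandardTableau.ext h.choose_spec)

theorem vec_of_not {P : StandardTableau n → Prop} {b : Fin n → ℕ × ℕ}
    (h : ¬ ∃ S : {S // P S}, S.1.box = b) : vec P b = 0 := by
  rw [vec, dif_neg h]

/-- The operator of the generator `T_i` in the seminormal form. -/
def seminormalOp (q : ℂ) (P : StandardTableau n → Prop) (i : Fin (n - 1)) :
    Module.End ℂ ({S // P S} →₀ ℂ) :=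
  Finsupp.linearCombination ℂ fun S : {S // P S} =>
    diagCoeff q (qContent q (S.1.box (lowIndex i))) (qContent q (S.1.box (highIndex i))) •
      vec P S.1.box +
    offCoeff q (qContent q (S.1.box (lowIndex i))) (qContent q (S.1.box (highIndex i))) •
      vec P (S.1.box ∘ simpleSwap i)

theorem simpleSwap_low (i : Fin (n - 1)) : simpleSwap i (lowIndex i) = highIndex i :=
  Equiv.swap_apply_left _ _

theorem simpleSwap_high (i : Fin (n - 1)) : simpleSwap i (highIndex i) = lowIndex i :=
  Equiv.swap_apply_right _ _

theorem offCoeff_eq_zero_of_le {q : ℂ} (hq : IsGenericUpTo n q) (hq0 : q ≠ 0)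
    (S : StandardTableau n) (i : Fin (n - 1)) (h : S.box (lowIndex i) ≤ S.box (highIndex i)) :
    offCoeff q (qContent q (S.box (lowIndex i))) (qContent q (S.box (highIndex i))) = 0 := by
  rw [offCoeff_eq_zero_iff hq0 (S.qContent_low_ne_high hq hq0 i)]
  rcases S.boxContent_of_le i h with h | h
  · left
    rw [qContent, qContent, h, mul_add, zpow_add₀ hq0, mul_comm]
    norm_cast
  · right
    rw [qContent, qContent, h, mul_add, zpow_add₀ hq0]
    norm_num
    field_simp

theorem offCoeff_ne_zero_of_not_le {q : ℂ} (hq : IsGenericUpTo n q) (hq0 : q ≠ 0)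
    (S : StandardTableau n) (i : Fin (n - 1)) (h : ¬ S.box (lowIndex i) ≤ S.box (highIndex i)) :
    offCoeff q (qContent q (S.box (lowIndex i))) (qContent q (S.box (highIndex i))) ≠ 0 := by
  rw [Ne, offCoeff_eq_zero_iff hq0 (S.qContent_low_ne_high hq hq0 i)]
  have h1 := S.boxContent_of_not_le i h
  have h2 := S.abs_boxContent_sub_lt (highIndex i) (lowIndex i)
  have key : ∀ x y : ℕ × ℕ, 2 ≤ |boxContent x - boxContent y| →
      |boxContent x - boxContent y| < n → qContent q x ≠ q ^ 2 * qContent q y := by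
    intro x y h1 h2 h3
    have := hq.qContent_mul_eq hq0 (x := x) (y := y) (e := 1) ?_ (by simpa using h3)
    · rw [this] at h1
      norm_num at h1
    · rw [abs_le]
      rw [abs_lt] at h2
      constructor <;> omega
  rintro (h3 | h3)
  · exact key _ _ h1 h2 h3
  · rw [abs_sub_comm] at h1 h2
    exact key _ _ h1 h2 h3

variable {P : StandardTableau n → Prop}

/-- The formula extends to arbitrary fillings: where an exchange leads from outside the class to a
tableau in it, the off-diagonal coefficient is zero. The relations can thus be verified formally,
without asking which exchanged fillings are standard. -/
theorem seminormalOp_vec {q : ℂ} (hq : IsGenericUpTo n q) (hq0 : q ≠ 0)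
    (hP : RearrangementClosed P) (i : Fin (n - 1)) (b : Fin n → ℕ × ℕ) :
    seminormalOp q P i (vec P b) =
      diagCoeff q (qContent q (b (lowIndex i))) (qContent q (b (highIndex i))) • vec P b +
      offCoeff q (qContent q (b (lowIndex i))) (qContent q (b (highIndex i))) •
        vec P (b ∘ simpleSwap i) := by
  by_cases h : ∃ S : {S // P S}, S.1.box = b
  · obtain ⟨S, rfl⟩ := h
    rw [vec_box, seminormalOp, Finsupp.linearCombination_single, one_smul, vec_box]
  · rw [vec_of_not h, map_zero, smul_zero, zero_add]
    by_cases h' : ∃ S : {S // P S}, S.1.box = b ∘ simpleSwap i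
    · obtain ⟨S, hS⟩ := h'
      have hb : b = S.1.box ∘ simpleSwap i := by
        rw [hS]; ext j : 1; simp [simpleSwap]
      have hle : S.1.box (lowIndex i) ≤ S.1.box (highIndex i) := by
        by_contra hle
        obtain ⟨S', hS'⟩ := S.1.exists_box_eq_comp_simpleSwap i hle
        exact h ⟨⟨S', hP _ _ _ hS' S.2⟩, hS'.trans hb.symm⟩
      have h0 := offCoeff_eq_zero_of_le hq hq0 S.1 i hle
      rw [offCoeff_comm] at h0
      rw [hb, Function.comp_apply, Function.comp_apply, simpleSwap_low, simpleSwap_high, h0,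
        zero_smul]
    · rw [vec_of_not h', smul_zero]

theorem comp_simpleSwap_self (b : Fin n → ℕ × ℕ) (i : Fin (n - 1)) :
    (b ∘ simpleSwap i) ∘ simpleSwap i = b := by
  ext j : 1; simp [simpleSwap]

/-- Operators which agree on the vectors of all standard tableaux are equal. -/
theorem end_ext {V : Type*} [AddCommGroup V] [Module ℂ V] {f g : ({S // P S} →₀ ℂ) →ₗ[ℂ] V}
    (h : ∀ S : {S // P S}, f (vec P S.1.box) = g (vec P S.1.box)) : f = g := by
  refine Finsupp.lhom_ext' fun S => LinearMap.ext_ring ?_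
  have := h S
  rw [vec_box] at this
  exact this

theorem seminormalOp_quad {q : ℂ} (hq : IsGenericUpTo n q) (hq0 : q ≠ 0)
    (hP : RearrangementClosed P) (i : Fin (n - 1)) :
    seminormalOp q P i * seminormalOp q P i = 1 + (q - q⁻¹) • seminormalOp q P i := by
  refine end_ext fun S => ?_
  have hne := S.1.qContent_low_ne_high hq hq0 i
  have h1 := offCoeff_mul_self_add (q := q) hne
  have h2 := diagCoeff_add_swap (q := q) hne
  simp only [Module.End.mul_apply, LinearMap.add_apply, LinearMap.smul_apply, Module.End.one_apply,
    seminormalOp_vec hq hq0 hP, map_add, map_smul, Function.comp_apply, simpleSwap_low,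
    simpleSwap_high, comp_simpleSwap_self]
  rw [offCoeff_comm q (qContent q (S.1.box (highIndex i)))]
  match_scalars
  · linear_combination h1
  · linear_combination offCoeff q (qContent q (S.1.box (lowIndex i)))
      (qContent q (S.1.box (highIndex i))) * h2

theorem seminormalOp_comm {q : ℂ} (hq : IsGenericUpTo n q) (hq0 : q ≠ 0)
    (hP : RearrangementClosed P) (i j : Fin (n - 1)) (hij : i.val + 1 < j.val) :
    seminormalOp q P i * seminormalOp q P j = seminormalOp q P j * seminormalOp q P i := by
  have h1 : simpleSwap i (lowIndex j) = lowIndex j :=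
    Equiv.swap_apply_of_ne_of_ne (by simp [lowIndex]; omega) (by simp [lowIndex, highIndex]; omega)
  have h2 : simpleSwap i (highIndex j) = highIndex j :=
    Equiv.swap_apply_of_ne_of_ne (by simp [lowIndex, highIndex]; omega)
      (by simp [highIndex]; omega)
  have h3 : simpleSwap j (lowIndex i) = lowIndex i :=
    Equiv.swap_apply_of_ne_of_ne (by simp [lowIndex]; omega) (by simp [lowIndex, highIndex]; omega)
  have h4 : simpleSwap j (highIndex i) = highIndex i :=
    Equiv.swap_apply_of_ne_of_ne (by simp [lowIndex, highIndex]; omega)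
      (by simp [highIndex]; omega)
  refine end_ext fun S => ?_
  have h5 : (S.1.box ∘ simpleSwap i) ∘ simpleSwap j = (S.1.box ∘ simpleSwap j) ∘ simpleSwap i := by
    rw [Function.comp_assoc, Function.comp_assoc, ← Equiv.Perm.coe_mul, ← Equiv.Perm.coe_mul]
    congr 2
    have h6 : (simpleSwap j * simpleSwap i * (simpleSwap j)⁻¹ : Equiv.Perm (Fin n)) =
        simpleSwap i := by
      nth_rw 2 [simpleSwap]
      rw [Equiv.mul_swap_eq_swap_mul, h3, h4, mul_assoc, mul_inv_cancel, mul_one]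
      rfl
    rw [mul_inv_eq_iff_eq_mul] at h6
    exact h6.symm
  simp only [Module.End.mul_apply, seminormalOp_vec hq hq0 hP, map_add, map_smul,
    Function.comp_apply, h1, h2, h3, h4, h5]
  match_scalars <;> ring

theorem seminormalOp_braid {q : ℂ} (hq : IsGenericUpTo n q) (hq0 : q ≠ 0)
    (hP : RearrangementClosed P) (i j : Fin (n - 1)) (hij : j.val = i.val + 1) :
    seminormalOp q P i * seminormalOp q P j * seminormalOp q P i =
      seminormalOp q P j * seminormalOp q P i * seminormalOp q P j := by
  have h0 : highIndex i = lowIndex j := by simp [lowIndex, highIndex, hij]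
  have h1 : simpleSwap i (highIndex j) = highIndex j :=
    Equiv.swap_apply_of_ne_of_ne (by simp [lowIndex, highIndex]; omega)
      (by simp [highIndex]; omega)
  have h2 : simpleSwap j (lowIndex i) = lowIndex i :=
    Equiv.swap_apply_of_ne_of_ne (by simp [lowIndex]; omega) (by simp [lowIndex, highIndex]; omega)
  have e1 : simpleSwap i (lowIndex j) = lowIndex i := by rw [← h0, simpleSwap_high]
  have e2 : simpleSwap i (lowIndex i) = lowIndex j := by rw [← h0, simpleSwap_low]
  refine end_ext fun S => ?_
  have hxy := S.1.qContent_low_ne_high hq hq0 i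
  have hyz := S.1.qContent_low_ne_high hq hq0 j
  have hxz := S.1.qContent_first_ne_third hq hq0 i j hij
  rw [h0] at hxy
  -- Both triple products of simple transpositions are the transposition of the two outer positions.
  have hbr : (((S.1.box ∘ simpleSwap j) ∘ simpleSwap i) ∘ simpleSwap j) =
      (((S.1.box ∘ simpleSwap i) ∘ simpleSwap j) ∘ simpleSwap i) := by
    simp only [Function.comp_assoc, ← Equiv.Perm.coe_mul]
    congr 2
    have h3 : (simpleSwap j * simpleSwap i * (simpleSwap j)⁻¹ : Equiv.Perm (Fin n)) =
        Equiv.swap (lowIndex i) (highIndex j) := by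
      nth_rw 2 [simpleSwap]
      rw [Equiv.mul_swap_eq_swap_mul, h2, h0, simpleSwap_low, mul_assoc, mul_inv_cancel, mul_one]
    have h4 : (simpleSwap i * simpleSwap j * (simpleSwap i)⁻¹ : Equiv.Perm (Fin n)) =
        Equiv.swap (lowIndex i) (highIndex j) := by
      nth_rw 2 [simpleSwap]
      rw [Equiv.mul_swap_eq_swap_mul, h1, e1, mul_assoc, mul_inv_cancel, mul_one]
    have h5 : ∀ k : Fin (n - 1), (simpleSwap k)⁻¹ = simpleSwap k := fun k => Equiv.swap_inv _ _
    rw [h5] at h3 h4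
    rw [h3, h4]
  rw [Module.End.mul_apply, Module.End.mul_apply, Module.End.mul_apply, Module.End.mul_apply]
  refine seminormal_braid (q := q) hxy hyz hxz _ _
    (v₁ := vec P (S.1.box ∘ simpleSwap i)) (v₂ := vec P (S.1.box ∘ simpleSwap j))
    (v₁₂ := vec P ((S.1.box ∘ simpleSwap i) ∘ simpleSwap j))
    (v₂₁ := vec P ((S.1.box ∘ simpleSwap j) ∘ simpleSwap i))
    (w := vec P (((S.1.box ∘ simpleSwap i) ∘ simpleSwap j) ∘ simpleSwap i))
    ?_ ?_ ?_ ?_ ?_ ?_ ?_ ?_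
  all_goals
    rw [seminormalOp_vec hq hq0 hP]
    try simp only [Function.comp_apply, h0, h1, h2, e1, e2, simpleSwap_low, simpleSwap_high,
      comp_simpleSwap_self, hbr]

end StandardTableau

/-! ### Universal property of the Hecke algebra and the seminormal representation. -/

namespace HeckeAlgebra

variable {n : ℕ} {q : ℂ}

/-- The universal property of the Hecke algebra. -/
def lift {A : Type*} [Ring A] [Algebra ℂ A] (f : Fin (n - 1) → A)
    (hbraid : ∀ i j : Fin (n - 1), j.val = i.val + 1 → f i * f j * f i = f j * f i * f j)
    (hcomm : ∀ i j : Fin (n - 1), i.val + 1 < j.val → f i * f j = f j * f i)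
    (hquad : ∀ i, f i * f i = 1 + (q - q⁻¹) • f i) : HeckeAlgebra n q →ₐ[ℂ] A :=
  RingQuot.liftAlgHom ℂ ⟨FreeAlgebra.lift ℂ f, by
    intro x y h
    induction h with
    | braid i j h => simpa using hbraid i j h
    | comm i j h => simpa using hcomm i j h
    | quad i => simpa using hquad i⟩

theorem lift_T {A : Type*} [Ring A] [Algebra ℂ A] (f : Fin (n - 1) → A)
    (hbraid : ∀ i j : Fin (n - 1), j.val = i.val + 1 → f i * f j * f i = f j * f i * f j)
    (hcomm : ∀ i j : Fin (n - 1), i.val + 1 < j.val → f i * f j = f j * f i)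
    (hquad : ∀ i, f i * f i = 1 + (q - q⁻¹) • f i) (i : Fin (n - 1)) :
    lift f hbraid hcomm hquad (T q i) = f i := by
  have := RingQuot.liftAlgHom_mkAlgHom_apply ℂ (FreeAlgebra.lift ℂ f) (s := HeckeRel n q)
    (w := by
      intro x y h
      induction h with
      | braid i j h => simpa using hbraid i j h
      | comm i j h => simpa using hcomm i j h
      | quad i => simpa using hquad i) (FreeAlgebra.ι ℂ i)
  rw [FreeAlgebra.lift_ι_apply] at this
  exact this

theorem T_braid (i j : Fin (n - 1)) (h : j.val = i.val + 1) :
    T q i * T q j * T q i = T q j * T q i * T q j := by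
  have := RingQuot.mkAlgHom_rel ℂ (HeckeRel.braid (q := q) i j h)
  rw [map_mul, map_mul, map_mul, map_mul] at this
  exact this

theorem T_comm (i j : Fin (n - 1)) (h : i.val + 1 < j.val) : T q i * T q j = T q j * T q i := by
  have := RingQuot.mkAlgHom_rel ℂ (HeckeRel.comm (q := q) i j h)
  rw [map_mul, map_mul] at this
  exact this

theorem T_quad (i : Fin (n - 1)) : T q i * T q i = 1 + (q - q⁻¹) • T q i := by
  have := RingQuot.mkAlgHom_rel ℂ (HeckeRel.quad (q := q) i)
  rw [map_mul, map_add, map_smul, map_one] at this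
  exact this

/-- The projection from the free algebra. -/
def ofFree (n : ℕ) (q : ℂ) : FreeAlgebra ℂ (Fin (n - 1)) →ₐ[ℂ] HeckeAlgebra n q :=
  RingQuot.mkAlgHom ℂ (HeckeRel n q)

theorem ofFree_surjective : Function.Surjective (ofFree n q) :=
  RingQuot.mkAlgHom_surjective ℂ (HeckeRel n q)

/-- A subspace containing `1` and stable under right multiplication by generators is everything. -/
theorem submodule_eq_top (N : Submodule ℂ (HeckeAlgebra n q)) (h1 : 1 ∈ N)
    (h : ∀ x ∈ N, ∀ i, x * T q i ∈ N) : N = ⊤ := by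
  rw [eq_top_iff]
  rintro x -
  obtain ⟨y, rfl⟩ := ofFree_surjective x
  have key : ∀ y : FreeAlgebra ℂ (Fin (n - 1)), ∀ z : HeckeAlgebra n q, z ∈ N →
      z * ofFree n q y ∈ N := by
    intro y
    induction y using FreeAlgebra.induction with
    | grade0 r =>
      intro z hz
      rw [AlgHom.commutes, ← Algebra.commutes, ← Algebra.smul_def]
      exact N.smul_mem r hz
    | grade1 i => exact fun z hz => h z hz i
    | mul a b ha hb =>
      intro z hz
      rw [map_mul, ← mul_assoc]
      exact hb _ (ha z hz)
    | add a b ha hb =>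
      intro z hz
      rw [map_add, mul_add]
      exact N.add_mem (ha z hz) (hb z hz)
  have := key y 1 h1
  rwa [one_mul] at this

open StandardTableau

/-- The seminormal representation of the Hecke algebra on the span of a class of tableaux. -/
def seminormalRep (hq : IsGenericUpTo n q) (hq0 : q ≠ 0) {P : StandardTableau n → Prop}
    (hP : RearrangementClosed P) : HeckeAlgebra n q →ₐ[ℂ] Module.End ℂ ({S // P S} →₀ ℂ) :=
  lift (seminormalOp q P) (seminormalOp_braid hq hq0 hP) (seminormalOp_comm hq hq0 hP)
    (seminormalOp_quad hq hq0 hP)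

theorem seminormalRep_T (hq : IsGenericUpTo n q) (hq0 : q ≠ 0) {P : StandardTableau n → Prop}
    (hP : RearrangementClosed P) (i : Fin (n - 1)) (b : Fin n → ℕ × ℕ) :
    seminormalRep hq hq0 hP (T q i) (vec P b) =
      diagCoeff q (qContent q (b (lowIndex i))) (qContent q (b (highIndex i))) • vec P b +
      offCoeff q (qContent q (b (lowIndex i))) (qContent q (b (highIndex i))) •
        vec P (b ∘ simpleSwap i) := by
  rw [seminormalRep, lift_T, seminormalOp_vec hq hq0 hP]

end HeckeAlgebra

/-! ### Young's lattice and the count of pairs of tableaux of equal shape. -/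

open Classical in
/-- The boxes which can be added to `D` to give a lower set. -/
def addableBoxes (D : Finset (ℕ × ℕ)) : Finset (ℕ × ℕ) :=
  (Finset.range (D.card + 1) ×ˢ Finset.range (D.card + 1)).filter
    fun x => x ∉ D ∧ IsLowerSet ((insert x D : Finset (ℕ × ℕ)) : Set (ℕ × ℕ))

open Classical in
/-- The boxes which can be removed from `D` to give a lower set. -/
def removableBoxes (D : Finset (ℕ × ℕ)) : Finset (ℕ × ℕ) :=
  D.filter fun x => IsLowerSet ((D.erase x : Finset (ℕ × ℕ)) : Set (ℕ × ℕ))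

/-- By the hook bound, the finite search range in `addableBoxes` excludes nothing. -/
theorem mem_addableBoxes {D : Finset (ℕ × ℕ)} {x : ℕ × ℕ} : x ∈ addableBoxes D ↔
    x ∉ D ∧ IsLowerSet ((insert x D : Finset (ℕ × ℕ)) : Set (ℕ × ℕ)) := by
  classical
  rw [addableBoxes, Finset.mem_filter, and_iff_right_iff_imp]
  rintro ⟨h1, h2⟩
  have := card_add_one_le_of_mem_lowerSet h2 (Finset.mem_insert_self x D)
    (Finset.mem_insert_self x D)
  rw [Finset.card_insert_of_notMem h1] at this
  simp only [Finset.mem_product, Finset.mem_range]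
  omega

theorem mem_removableBoxes {D : Finset (ℕ × ℕ)} {x : ℕ × ℕ} : x ∈ removableBoxes D ↔
    x ∈ D ∧ IsLowerSet ((D.erase x : Finset (ℕ × ℕ)) : Set (ℕ × ℕ)) := by
  classical
  rw [removableBoxes, Finset.mem_filter]

/-- A removable corner in row `i` corresponds to the addable box at the end of row `i + 1`, since
both exist exactly when row `i + 1` is shorter than row `i`. Row `0` gives one more addable box.
This is the relation `DU - UD = 1` of Young's lattice. -/
theorem card_addableBoxes {D : Finset (ℕ × ℕ)} (hD : IsLowerSet (D : Set (ℕ × ℕ))) :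
    (addableBoxes D).card = (removableBoxes D).card + 1 := by
  let μ : YoungDiagram := ⟨D, hD⟩
  obtain ⟨r, hr, hmem⟩ : ∃ r : ℕ → ℕ, Antitone r ∧ ∀ i j, (i, j) ∈ D ↔ j < r i :=
    ⟨μ.rowLen, fun _ _ h => μ.rowLen_anti _ _ h, fun i j => μ.mem_iff_lt_rowLen⟩
  have hadd : ∀ i j, (i, j) ∈ addableBoxes D ↔ j = r i ∧ (i = 0 ∨ r i < r (i - 1)) := by
    intro i j
    rw [mem_addableBoxes, hmem, not_lt]
    constructor
    · rintro ⟨h1, h2⟩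
      have hself : (i, j) ∈ ((insert (i, j) D : Finset (ℕ × ℕ)) : Set (ℕ × ℕ)) := by simp
      have hj : j = r i := by
        by_contra hne
        have h3 := h2 (show (i, r i) ≤ (i, j) from ⟨le_rfl, h1⟩) hself
        simp only [Finset.coe_insert, Set.mem_insert_iff, Prod.mk.injEq, true_and,
          Finset.mem_coe, hmem, lt_irrefl, or_false] at h3
        exact hne h3.symm
      refine ⟨hj, ?_⟩
      rcases Nat.eq_zero_or_pos i with h0 | h0
      · exact Or.inl h0
      · right
        have h3 := h2 (show (i - 1, j) ≤ (i, j) from ⟨Nat.sub_le _ _, le_rfl⟩) hself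
        simp only [Finset.coe_insert, Set.mem_insert_iff, Prod.mk.injEq, and_true,
          Finset.mem_coe, hmem] at h3
        omega
    · rintro ⟨rfl, h⟩
      refine ⟨le_rfl, ?_⟩
      rintro ⟨i₁, j₁⟩ ⟨i₂, j₂⟩ hle h2
      simp only [Finset.coe_insert, Set.mem_insert_iff, Prod.mk.injEq, Finset.mem_coe, hmem] at h2 ⊢
      rw [Prod.mk_le_mk] at hle
      rcases h2 with ⟨rfl, rfl⟩ | h2
      · rcases hle.1.lt_or_eq with hlt | rfl
        · right
          have h3 := hr (show i₂ ≤ i₁ - 1 by omega)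
          omega
        · omega
      · have h3 := hr hle.1
        omega
  have hrem : ∀ i j, (i, j) ∈ removableBoxes D ↔ j + 1 = r i ∧ r (i + 1) < r i := by
    intro i j
    rw [mem_removableBoxes, hmem]
    constructor
    · rintro ⟨h1, h2⟩
      have h3 : ∀ x, (i, j) ≤ x → x ≠ (i, j) → x ∉ D := by
        intro x hx hne hxD
        have := h2 hx (by simp [hne, hxD])
        simp at this
      have h4 := h3 (i, j + 1) ⟨le_rfl, Nat.le_succ _⟩ (by simp)
      have h5 := h3 (i + 1, j) ⟨Nat.le_succ _, le_rfl⟩ (by simp)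
      rw [hmem] at h4 h5
      omega
    · rintro ⟨h1, h2⟩
      refine ⟨by omega, ?_⟩
      rintro ⟨i₁, j₁⟩ ⟨i₂, j₂⟩ hle h3
      simp only [Finset.coe_erase, Set.mem_sdiff, Set.mem_singleton_iff, Prod.mk.injEq,
        Finset.mem_coe, hmem] at h3 ⊢
      rw [Prod.mk_le_mk] at hle
      have h4 := hr hle.1
      refine ⟨by omega, ?_⟩
      rintro ⟨rfl, rfl⟩
      rcases hle.1.lt_or_eq with hlt | rfl
      · have h5 := hr (show i₂ + 1 ≤ i₁ from hlt)
        omega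
      · omega
  have himage : addableBoxes D =
      insert (0, r 0) ((removableBoxes D).image fun y => (y.1 + 1, r (y.1 + 1))) := by
    ext ⟨i, j⟩
    rw [hadd, Finset.mem_insert, Finset.mem_image]
    constructor
    · rintro ⟨rfl, rfl | h⟩
      · exact Or.inl rfl
      · rcases Nat.eq_zero_or_pos i with rfl | h0
        · exact Or.inl rfl
        · refine Or.inr ⟨(i - 1, r (i - 1) - 1), ?_, ?_⟩
          · rw [hrem, Nat.sub_add_cancel h0]
            omega
          · simp [Nat.sub_add_cancel h0]
    · rintro (h | ⟨⟨i', j'⟩, h, h'⟩)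
      · rw [Prod.mk.injEq] at h
        obtain ⟨rfl, rfl⟩ := h
        exact ⟨rfl, Or.inl rfl⟩
      · rw [Prod.mk.injEq] at h'
        obtain ⟨rfl, rfl⟩ := h'
        rw [hrem] at h
        exact ⟨rfl, Or.inr (by simpa using h.2)⟩
  rw [himage, Finset.card_insert_of_notMem, Finset.card_image_of_injOn]
  · rintro ⟨i, j⟩ h ⟨i', j'⟩ h' he
    rw [Finset.mem_coe, hrem] at h h'
    simp only [Prod.mk.injEq] at he ⊢
    obtain rfl : i = i' := by omega
    omega
  · simp

namespace StandardTableau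

variable {n : ℕ}

/-- The tableau obtained by removing the last box. -/
def restrict (U : StandardTableau (n + 1)) : StandardTableau n :=
  ofBoxes (fun i => U.box i.castSucc)
    (U.injective.comp (Fin.castSucc_injective n)) <| by
    intro i x hx
    obtain ⟨k, hk, e⟩ := U.exists_box_eq_of_le hx
    have hkn : k.val < n := lt_of_le_of_lt (Fin.le_def.mp hk) i.isLt
    exact ⟨⟨k.val, hkn⟩, hk, e⟩

theorem boxes_eq_insert (U : StandardTableau (n + 1)) :
    U.boxes = insert (U.box (Fin.last n)) U.restrict.boxes := by
  ext x
  rw [Finset.mem_insert, mem_boxes, mem_boxes, Fin.exists_fin_succ', or_comm, eq_comm (a := x)]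
  rfl

theorem last_notMem (U : StandardTableau (n + 1)) : U.box (Fin.last n) ∉ U.restrict.boxes := by
  rw [mem_boxes]
  rintro ⟨i, hi⟩
  exact (Fin.castSucc_lt_last i).ne (U.injective hi)

theorem restrict_boxes (U : StandardTableau (n + 1)) :
    U.restrict.boxes = U.boxes.erase (U.box (Fin.last n)) := by
  rw [boxes_eq_insert, Finset.erase_insert U.last_notMem]

theorem ext_of_restrict {U V : StandardTableau (n + 1)} (h : U.restrict = V.restrict)
    (h' : U.box (Fin.last n) = V.box (Fin.last n)) : U = V := by
  ext i : 2
  induction i using Fin.lastCases with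
  | last => exact h'
  | cast i => exact congrArg (fun W : StandardTableau n => W.box i) h

theorem exists_restrict_eq (S : StandardTableau n) {x : ℕ × ℕ} (hx : x ∈ addableBoxes S.boxes) :
    ∃ U : StandardTableau (n + 1), U.restrict = S ∧ U.box (Fin.last n) = x := by
  rw [mem_addableBoxes] at hx
  refine ⟨ofBoxes (Fin.snoc (α := fun _ => ℕ × ℕ) S.box x) ?_ ?_, ?_, ?_⟩
  · rw [Fin.snoc_injective_iff]
    refine ⟨S.injective, ?_⟩
    rintro ⟨i, hi⟩
    exact hx.1 (S.mem_boxes.mpr ⟨i, hi⟩)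
  · intro i y hy
    induction i using Fin.lastCases with
    | last =>
      rw [Fin.snoc_last] at hy
      have := hx.2 hy (by simp)
      rw [Finset.mem_coe, Finset.mem_insert, mem_boxes] at this
      rcases this with rfl | ⟨k, rfl⟩
      · exact ⟨Fin.last n, le_rfl, Fin.snoc_last _ _⟩
      · exact ⟨k.castSucc, Fin.le_last _, Fin.snoc_castSucc _ _ _⟩
    | cast i =>
      rw [Fin.snoc_castSucc] at hy
      obtain ⟨k, hk, rfl⟩ := S.exists_box_eq_of_le hy
      exact ⟨k.castSucc, by simpa using hk, Fin.snoc_castSucc _ _ _⟩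
  · ext i : 2
    exact Fin.snoc_castSucc (α := fun _ => ℕ × ℕ) x S.box i
  · exact Fin.snoc_last (α := fun _ => ℕ × ℕ) x S.box

theorem last_mem_addableBoxes (U : StandardTableau (n + 1)) :
    U.box (Fin.last n) ∈ addableBoxes U.restrict.boxes := by
  rw [mem_addableBoxes, ← boxes_eq_insert]
  exact ⟨U.last_notMem, U.isLowerSet_boxes⟩

open Classical in
/-- The number of standard tableaux with a given set of boxes. -/
def countBoxes (n : ℕ) (D : Finset (ℕ × ℕ)) : ℕ :=
  (Finset.univ.filter fun U : StandardTableau n => U.boxes = D).card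

/-- The last entry occupies a removable box, and erasing it loses no other information. -/
theorem countBoxes_succ {D : Finset (ℕ × ℕ)} (hD : IsLowerSet (D : Set (ℕ × ℕ))) :
    countBoxes (n + 1) D = ∑ x ∈ removableBoxes D, countBoxes n (D.erase x) := by
  classical
  rw [countBoxes, Finset.card_eq_sum_card_fiberwise (t := removableBoxes D)
    (f := fun U => U.box (Fin.last n))]
  · refine Finset.sum_congr rfl fun x hx => ?_
    rw [mem_removableBoxes] at hx
    rw [countBoxes]
    refine Finset.card_bij (fun U _ => U.restrict) ?_ ?_ ?_
    · intro U hU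
      simp only [Finset.mem_filter, Finset.mem_univ, true_and] at hU ⊢
      rw [restrict_boxes, hU.1, hU.2]
    · intro U hU V hV h
      simp only [Finset.mem_filter, Finset.mem_univ, true_and] at hU hV
      exact ext_of_restrict h (hU.2.trans hV.2.symm)
    · intro S hS
      simp only [Finset.mem_filter, Finset.mem_univ, true_and] at hS
      obtain ⟨U, hU, hU'⟩ := S.exists_restrict_eq (x := x) (by
        rw [mem_addableBoxes, hS, Finset.insert_erase hx.1]
        exact ⟨by simp, hD⟩)
      refine ⟨U, ?_, hU⟩
      simp only [Finset.mem_filter, Finset.mem_univ, true_and]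
      rw [boxes_eq_insert, hU, hU', hS, Finset.insert_erase hx.1]
      exact ⟨rfl, rfl⟩
  · intro U hU
    simp only [Finset.coe_filter, Finset.mem_univ, true_and, Set.mem_ofPred_eq] at hU
    rw [Finset.mem_coe, mem_removableBoxes, ← hU, ← restrict_boxes]
    exact ⟨U.box_mem_boxes _, U.restrict.isLowerSet_boxes⟩

/-- Adding `x` and removing a different `y` commute. The lower-set conditions for the two orders
imply each other by intersecting or uniting the diagrams involved. -/
theorem sum_addableBoxes_comm {D : Finset (ℕ × ℕ)} (hD : IsLowerSet (D : Set (ℕ × ℕ)))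
    (f : Finset (ℕ × ℕ) → ℕ) :
    ∑ x ∈ addableBoxes D, ∑ y ∈ (removableBoxes (insert x D)).erase x, f ((insert x D).erase y) =
    ∑ y ∈ removableBoxes D, ∑ x ∈ (addableBoxes (D.erase y)).erase y,
      f (insert x (D.erase y)) := by
  rw [Finset.sum_comm' (t' := removableBoxes D) (s' := fun y => (addableBoxes (D.erase y)).erase y)]
  · refine Finset.sum_congr rfl fun y _ => Finset.sum_congr rfl fun x hx => ?_
    rw [Finset.mem_erase] at hx
    rw [Finset.erase_insert_of_ne hx.1]
  · intro x y
    simp only [mem_addableBoxes, mem_removableBoxes, Finset.mem_erase, Finset.mem_insert]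
    constructor
    · rintro ⟨⟨h1, h2⟩, h3, h4, h5⟩
      have hy : y ∈ D := h4.resolve_left h3
      rw [Finset.erase_insert_of_ne h3.symm] at h5
      refine ⟨⟨h3.symm, fun h => h1 h.2, h5⟩, hy, ?_⟩
      have := hD.inter h5
      convert this using 1
      ext z
      simp only [Finset.coe_erase, Finset.coe_insert, Set.mem_inter_iff, Set.mem_insert_iff,
        Set.mem_sdiff, Finset.mem_coe, Set.mem_singleton_iff]
      constructor
      · tauto
      · rintro ⟨h6, rfl | h7⟩
        · exact absurd h6 h1
        · exact h7
    · rintro ⟨⟨h1, h2, h3⟩, h4, h5⟩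
      have hx : x ∉ D := fun h => h2 ⟨h1, h⟩
      refine ⟨⟨hx, ?_⟩, h1.symm, Or.inr h4, ?_⟩
      · have := hD.union h3
        convert this using 1
        ext z
        simp only [Finset.coe_erase, Finset.coe_insert, Set.mem_union, Set.mem_insert_iff,
          Set.mem_sdiff, Finset.mem_coe, Set.mem_singleton_iff]
        tauto
      · rwa [Finset.erase_insert_of_ne h1]

theorem countBoxes_insert {D : Finset (ℕ × ℕ)} {x : ℕ × ℕ} (hD : IsLowerSet (D : Set (ℕ × ℕ)))
    (hx : x ∈ addableBoxes D) : countBoxes (n + 1) (insert x D) = countBoxes n D +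
      ∑ y ∈ (removableBoxes (insert x D)).erase x, countBoxes n ((insert x D).erase y) := by
  rw [mem_addableBoxes] at hx
  rw [countBoxes_succ hx.2, ← Finset.add_sum_erase _ _ (a := x), Finset.erase_insert hx.1]
  rw [mem_removableBoxes, Finset.erase_insert hx.1]
  exact ⟨by simp, hD⟩

/-- Classify the tableaux on `insert x D` by the box `y` of their last entry. The case `y = x`
contributes one copy of the count for `D` per addable box; the cases `y ≠ x` are rewritten through
`D.erase y` and fall under the induction hypothesis. -/
theorem sum_countBoxes_insert (n : ℕ) {D : Finset (ℕ × ℕ)} (hD : IsLowerSet (D : Set (ℕ × ℕ))) :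
    ∑ x ∈ addableBoxes D, countBoxes (n + 1) (insert x D) = (n + 1) * countBoxes n D := by
  induction n generalizing D with
  | zero =>
    have h0 : ∀ D', countBoxes 0 D' = if D' = ∅ then 1 else 0 := by
      intro D'
      rw [countBoxes]
      have : ∀ U : StandardTableau 0, U.boxes = ∅ := fun U => by simp [boxes]
      simp only [this, eq_comm (a := ∅)]
      have hcard : Fintype.card (StandardTableau 0) = 1 := by
        rw [Fintype.card_eq_one_iff]
        refine ⟨ofBoxes (fun i => i.elim0) (fun i => i.elim0) (fun i => i.elim0), fun U => ?_⟩
        ext i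
        · exact i.elim0
        · exact i.elim0
      split_ifs with h
      · simp [h, hcard]
      · simp [h]
    rw [Finset.sum_congr rfl fun x hx => countBoxes_insert hD hx, Finset.sum_add_distrib,
      sum_addableBoxes_comm hD]
    have h1 : ∑ y ∈ removableBoxes D, ∑ x ∈ (addableBoxes (D.erase y)).erase y,
        countBoxes 0 (insert x (D.erase y)) = 0 := by
      refine Finset.sum_eq_zero fun y _ => Finset.sum_eq_zero fun x _ => ?_
      rw [h0, if_neg (Finset.insert_ne_empty _ _)]
    rw [h1, Finset.sum_const, card_addableBoxes hD, h0]
    split_ifs with h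
    · subst h
      have : removableBoxes ∅ = ∅ := by
        ext x; simp [mem_removableBoxes]
      simp [this]
    · simp
  | succ n ih =>
    rw [Finset.sum_congr rfl fun x hx => countBoxes_insert hD hx, Finset.sum_add_distrib,
      sum_addableBoxes_comm hD, Finset.sum_const, card_addableBoxes hD]
    -- In the induction hypothesis for `D.erase y` the term `x = y` restores `D`; these terms make
    -- up the multiple by the number of removable boxes.
    have h1 : (n + 1) * countBoxes (n + 1) D = (removableBoxes D).card * countBoxes (n + 1) D +
        ∑ y ∈ removableBoxes D, ∑ x ∈ (addableBoxes (D.erase y)).erase y,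
          countBoxes (n + 1) (insert x (D.erase y)) := by
      nth_rw 1 [countBoxes_succ hD]
      rw [Finset.mul_sum, ← smul_eq_mul (a := (removableBoxes D).card), ← Finset.sum_const,
        ← Finset.sum_add_distrib]
      refine Finset.sum_congr rfl fun y hy => ?_
      rw [mem_removableBoxes] at hy
      rw [← ih hy.2, ← Finset.add_sum_erase _ _ (a := y), Finset.insert_erase hy.1]
      rw [mem_addableBoxes, Finset.insert_erase hy.1]
      exact ⟨by simp, hD⟩
    rw [add_smul, one_smul, smul_eq_mul, add_right_comm, ← h1]
    ring

/-- The left side is the sum of the squares of the numbers of tableaux of each shape; grouping `U`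
by its restriction produces the factor `n + 1`. -/
theorem sum_countBoxes_boxes (n : ℕ) :
    ∑ U : StandardTableau n, countBoxes n U.boxes = n.factorial := by
  classical
  induction n with
  | zero =>
    have hU : ∀ U V : StandardTableau 0, U = V := fun U V => by
      ext i
      · exact i.elim0
      · exact i.elim0
    let U₀ : StandardTableau 0 :=
      ofBoxes (fun i => i.elim0) (fun i => i.elim0) (fun i => i.elim0)
    have huniv : (Finset.univ : Finset (StandardTableau 0)) = {U₀} := by
      ext U; simp [hU U U₀]
    simp [countBoxes, huniv, Finset.filter_singleton]
  | succ n ih =>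
    rw [← Finset.sum_fiberwise (g := fun U : StandardTableau (n + 1) => U.restrict),
      Nat.factorial_succ, ← ih, Finset.mul_sum]
    refine Finset.sum_congr rfl fun S _ => ?_
    rw [← sum_countBoxes_insert n S.isLowerSet_boxes]
    refine Finset.sum_bij (fun U _ => U.box (Fin.last n)) ?_ ?_ ?_ ?_
    · intro U hU
      simp only [Finset.mem_filter, Finset.mem_univ, true_and] at hU
      rw [← hU]
      exact U.last_mem_addableBoxes
    · intro U hU V hV h
      simp only [Finset.mem_filter, Finset.mem_univ, true_and] at hU hV
      exact ext_of_restrict (hU.trans hV.symm) h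
    · intro x hx
      obtain ⟨U, hU, hU'⟩ := S.exists_restrict_eq hx
      exact ⟨U, by simpa using hU, hU'⟩
    · intro U hU
      simp only [Finset.mem_filter, Finset.mem_univ, true_and] at hU
      rw [boxes_eq_insert, hU]

/-- Pairs of standard tableaux of the same shape. -/
abbrev SameShapePair (n : ℕ) : Type :=
  {p : StandardTableau n × StandardTableau n // p.1.boxes = p.2.boxes}

theorem card_sameShapePair (n : ℕ) : Nat.card (SameShapePair n) = n.factorial := by
  classical
  rw [← sum_countBoxes_boxes, Nat.card_eq_fintype_card, Fintype.card_subtype,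
    Finset.card_eq_sum_card_fiberwise (t := Finset.univ) (f := Prod.snd) (fun _ _ => by simp)]
  refine Finset.sum_congr rfl fun U _ => ?_
  rw [countBoxes]
  refine Finset.card_bij (fun p _ => p.1) ?_ ?_ ?_
  · rintro ⟨S, U'⟩ h
    simp only [Finset.mem_filter, Finset.mem_univ, true_and] at h ⊢
    rw [← h.2]; exact h.1
  · rintro ⟨S, V⟩ h ⟨S', V'⟩ h' e
    simp only [Finset.mem_filter, Finset.mem_univ, true_and] at h h'
    exact Prod.ext e (h.2.trans h'.2.symm)
  · intro S hS
    simp only [Finset.mem_filter, Finset.mem_univ, true_and] at hS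
    exact ⟨(S, U), by simpa using hS, rfl⟩

end StandardTableau

/-! ### Normal forms of words and the upper bound `n!` for the dimension. -/

namespace HeckeAlgebra

/-- The generators indexed by natural numbers. -/
def gen (n : ℕ) (q : ℂ) (i : ℕ) : HeckeAlgebra n q :=
  -- The default value `1` lets `gen_comm` hold without range conditions.
  if h : i < n - 1 then T q ⟨i, h⟩ else 1

variable {n : ℕ} {q : ℂ}

theorem T_eq_gen (i : Fin (n - 1)) : T q i = gen n q i.val := by
  rw [gen, dif_pos i.isLt]

theorem gen_braid {i : ℕ} (h : i + 2 < n) :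
    gen n q i * gen n q (i + 1) * gen n q i = gen n q (i + 1) * gen n q i * gen n q (i + 1) := by
  rw [gen, gen, dif_pos (by omega), dif_pos (by omega)]
  exact T_braid _ _ rfl

theorem gen_comm {i j : ℕ} (h : i + 1 < j) : Commute (gen n q i) (gen n q j) := by
  rw [gen, gen]
  split_ifs
  · exact T_comm _ _ h
  · exact Commute.one_right _
  · exact Commute.one_left _
  · exact Commute.one_left _

theorem gen_quad {i : ℕ} (h : i + 1 < n) :
    gen n q i * gen n q i = 1 + (q - q⁻¹) • gen n q i := by
  rw [gen, dif_pos (by omega)]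
  exact T_quad _

/-- The product `T_{j+l-1} ⋯ T_{j+1} T_j`. -/
def descWord (n : ℕ) (q : ℂ) (j : ℕ) : ℕ → HeckeAlgebra n q
  | 0 => 1
  | l + 1 => gen n q (j + l) * descWord n q j l

theorem descWord_succ' (j l : ℕ) :
    descWord n q j (l + 1) = descWord n q (j + 1) l * gen n q j := by
  induction l with
  | zero => simp [descWord]
  | succ l ih =>
    rw [descWord, ih, descWord, mul_assoc]
    congr 2
    omega

theorem gen_comm_descWord {i j l : ℕ} (h : i + 1 < j) :
    Commute (gen n q i) (descWord n q j l) := by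
  induction l with
  | zero => exact Commute.one_right _
  | succ l ih => exact (gen_comm (by omega)).mul_right ih

theorem descWord_comm_gen {i j l : ℕ} (h : j + l < i) :
    Commute (descWord n q j l) (gen n q i) := by
  induction l with
  | zero => exact Commute.one_left _
  | succ l ih => exact Commute.mul_left (gen_comm (by omega)) (ih (by omega))

/-- The generator commutes past the smaller ones, a braid move at `T_{i+1} T_i` lowers its index by
one, and the result commutes past the larger ones. -/
theorem descWord_mul_gen {i j l : ℕ} (hl : j + l < n) (h1 : j < i + 1) (h2 : i + 1 < j + l) :
    descWord n q j l * gen n q (i + 1) = gen n q i * descWord n q j l := by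
  induction l with
  | zero => omega
  | succ l ih =>
    rcases (show i + 1 < j + l ∨ i + 1 = j + l by omega) with h | h
    · rw [descWord, mul_assoc, ih (by omega) h, ← mul_assoc, ← mul_assoc, (gen_comm h).eq]
    · obtain ⟨l, rfl⟩ : ∃ l', l = l' + 1 := ⟨l - 1, by omega⟩
      have h3 : j + l = i := by omega
      rw [descWord, descWord, ← h, h3, mul_assoc, mul_assoc,
        (descWord_comm_gen (j := j) (l := l) (i := i + 1) (by omega)).eq, ← mul_assoc, ← mul_assoc,
        ← gen_braid (by omega)]
      simp only [mul_assoc]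

open Classical in
/-- A spanning set of the subalgebra generated by the first `k - 1` generators. -/
def spanningSet (n : ℕ) (q : ℂ) : ℕ → Finset (HeckeAlgebra n q)
  | 0 => {1}
  -- The `k + 1` descending words, empty for `j = k`, play the role of coset representatives of
  -- `S_k` in `S_{k+1}`.
  | k + 1 => Finset.image₂ (· * ·) (spanningSet n q k)
      ((Finset.range (k + 1)).image fun j => descWord n q j (k - j))

theorem card_spanningSet_le (k : ℕ) : (spanningSet n q k).card ≤ k.factorial := by
  classical
  induction k with
  | zero => simp [spanningSet]
  | succ k ih =>
    rw [spanningSet, Nat.factorial_succ, mul_comm]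
    refine (Finset.card_image₂_le _ _ _).trans (Nat.mul_le_mul ih ?_)
    exact Finset.card_image_le.trans (Finset.card_range _).le

theorem mul_descWord_mem_span {k j : ℕ} (hj : j ≤ k) {x : HeckeAlgebra n q}
    (hx : x ∈ Submodule.span ℂ (spanningSet n q k : Set (HeckeAlgebra n q))) :
    x * descWord n q j (k - j) ∈
      Submodule.span ℂ (spanningSet n q (k + 1) : Set (HeckeAlgebra n q)) := by
  classical
  induction hx using Submodule.span_induction with
  | mem x hx =>
    refine Submodule.subset_span ?_
    rw [spanningSet]
    exact Finset.mem_coe.mpr (Finset.mem_image₂_of_mem hx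
      (Finset.mem_image_of_mem _ (Finset.mem_range.mpr (Nat.lt_succ_of_le hj))))
  | zero => rw [zero_mul]; exact Submodule.zero_mem _
  | add x y _ _ hx hy => rw [add_mul]; exact Submodule.add_mem _ hx hy
  | smul a x _ hx => rw [smul_mul_assoc]; exact Submodule.smul_mem _ _ hx

theorem mul_gen_mem_span {k : ℕ} (hk : k ≤ n) {x : HeckeAlgebra n q}
    (hx : x ∈ Submodule.span ℂ (spanningSet n q k : Set (HeckeAlgebra n q))) {i : ℕ}
    (hi : i + 1 < k) :
    x * gen n q i ∈ Submodule.span ℂ (spanningSet n q k : Set (HeckeAlgebra n q)) := by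
  classical
  induction k generalizing x i with
  | zero => omega
  | succ k ih =>
    induction hx using Submodule.span_induction with
    | mem x hx =>
      rw [Finset.mem_coe, spanningSet, Finset.mem_image₂] at hx
      obtain ⟨b, hb, d, hd, rfl⟩ := hx
      rw [Finset.mem_image] at hd
      obtain ⟨j, hj, rfl⟩ := hd
      rw [Finset.mem_range] at hj
      have hb' := Submodule.subset_span (R := ℂ) (Finset.mem_coe.mpr hb)
      rw [mul_assoc]
      -- The generator extends the word, is absorbed by the quadratic relation, commutes with the
      -- word, or passes through it with its index lowered. The last two cases use the induction on
      -- `k`.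
      rcases (show j = i + 1 ∨ j = i ∨ i + 1 < j ∨ j < i by omega) with h | h | h | h
      · have h1 : k - i = (k - j) + 1 := by omega
        rw [h, ← h, h, ← descWord_succ', ← h, ← h1]
        exact mul_descWord_mem_span (by omega) hb'
      · have h1 : k - j = (k - (i + 1)) + 1 := by omega
        have h2 : descWord n q j (k - j) * gen n q i =
            descWord n q (i + 1) (k - (i + 1)) + (q - q⁻¹) • descWord n q j (k - j) := by
          rw [h1, h, descWord_succ', mul_assoc, gen_quad (by omega), mul_add, mul_one,
            mul_smul_comm]
        rw [h2, mul_add, mul_smul_comm]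
        exact Submodule.add_mem _ (mul_descWord_mem_span (by omega) hb')
          (Submodule.smul_mem _ _ (mul_descWord_mem_span (by omega) hb'))
      · rw [← (gen_comm_descWord h).eq, ← mul_assoc]
        exact mul_descWord_mem_span (by omega) (ih (by omega) hb' (by omega))
      · obtain ⟨i, rfl⟩ : ∃ i', i = i' + 1 := ⟨i - 1, by omega⟩
        rw [descWord_mul_gen (by omega) (by omega) (by omega), ← mul_assoc]
        exact mul_descWord_mem_span (by omega) (ih (by omega) hb' (by omega))
    | zero => rw [zero_mul]; exact Submodule.zero_mem _
    | add x y _ _ hx hy => rw [add_mul]; exact Submodule.add_mem _ hx hy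
    | smul a x _ hx => rw [smul_mul_assoc]; exact Submodule.smul_mem _ _ hx

theorem one_mem_span (k : ℕ) :
    (1 : HeckeAlgebra n q) ∈
      Submodule.span ℂ (spanningSet n q k : Set (HeckeAlgebra n q)) := by
  induction k with
  | zero => exact Submodule.subset_span (by simp [spanningSet])
  | succ k ih =>
    have := mul_descWord_mem_span (j := k) le_rfl ih
    rwa [Nat.sub_self, descWord, mul_one] at this

theorem span_spanningSet :
    Submodule.span ℂ (spanningSet n q n : Set (HeckeAlgebra n q)) = ⊤ := by
  refine submodule_eq_top _ (one_mem_span n) fun x hx i => ?_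
  rw [T_eq_gen]
  exact mul_gen_mem_span le_rfl hx (by have := i.isLt; omega)

instance finiteDimensional : FiniteDimensional ℂ (HeckeAlgebra n q) :=
  ⟨⟨spanningSet n q n, span_spanningSet⟩⟩

theorem finrank_le (n : ℕ) (q : ℂ) : Module.finrank ℂ (HeckeAlgebra n q) ≤ n.factorial := by
  rw [← finrank_top, ← span_spanningSet]
  exact (finrank_span_finset_le_card _).trans (card_spanningSet_le n)

end HeckeAlgebra

/-! ### Spectrum of the Jucys–Murphy elements, spectral projectors and faithfulness. -/

namespace HeckeAlgebra

open StandardTableau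

theorem ascProd_succ {A : Type*} [Monoid A] {j : ℕ} (f : Fin (j + 1) → A) :
    ascProd f = ascProd (fun k : Fin j => f k.castSucc) * f (Fin.last j) := by
  rw [ascProd, List.ofFn_succ', List.concat_eq_append, List.prod_append, List.prod_singleton]
  rfl

theorem descProd_succ {A : Type*} [Monoid A] {j : ℕ} (f : Fin (j + 1) → A) :
    descProd f = f (Fin.last j) * descProd (fun k : Fin j => f k.castSucc) := by
  rw [descProd, List.ofFn_succ', List.concat_eq_append, List.reverse_append, List.prod_append]
  simp [descProd]

theorem ascProd_zero {A : Type*} [Monoid A] (f : Fin 0 → A) : ascProd f = 1 := by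
  simp [ascProd]

theorem descProd_zero {A : Type*} [Monoid A] (f : Fin 0 → A) : descProd f = 1 := by
  simp [descProd]

/-- The Jucys--Murphy elements indexed by natural numbers. -/
def jm (n : ℕ) (q : ℂ) : ℕ → HeckeAlgebra n q
  | 0 => 1
  | j + 1 => gen n q j * jm n q j * gen n q j

variable {n : ℕ} {q : ℂ}

theorem T_genIndex (j : Fin n) (k : Fin j.val) : T q (genIndex j k) = gen n q k.val :=
  T_eq_gen _

theorem jucysMurphy_eq_jm (j : Fin n) : jucysMurphy q j = jm n q j.val := by
  simp only [jucysMurphy, T_genIndex]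
  generalize j.val = m
  induction m with
  | zero => rw [ascProd_zero, descProd_zero, jm, mul_one]
  | succ m ih =>
    rw [ascProd_succ, descProd_succ, jm, ← ih]
    simp only [Fin.val_castSucc, Fin.val_last, mul_assoc]

/-- The quantum contents of a tableau indexed by natural numbers. -/
def contentAt (q : ℂ) (S : StandardTableau n) (k : ℕ) : ℂ :=
  if h : k < n then S.quantumContent q ⟨k, h⟩ else 1

theorem contentAt_val (S : StandardTableau n) (k : Fin n) :
    contentAt q S k.val = S.quantumContent q k := by
  rw [contentAt, dif_pos k.isLt]

/-- By `jm (k + 1) = T_k jm k T_k` the claim is a 2×2 computation: conjugating the diagonal action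
`(c, d)` on `v_S` and the exchanged vector by the symmetric block gives the eigenvalue `d` on `v_S`.
-/
theorem seminormalRep_jm (hq : IsGenericUpTo n q) (hq0 : q ≠ 0) {P : StandardTableau n → Prop}
    (hP : RearrangementClosed P) {k : ℕ} (hk : k < n) (b : Fin n → ℕ × ℕ) :
    seminormalRep hq hq0 hP (jm n q k) (vec P b) = qContent q (b ⟨k, hk⟩) • vec P b := by
  induction k generalizing b with
  | zero =>
    rw [jm, map_one, Module.End.one_apply]
    by_cases h : ∃ S : {S // P S}, S.1.box = b
    · obtain ⟨S, rfl⟩ := h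
      rw [S.1.box_zero _ rfl, qContent, boxContent]
      simp
    · rw [vec_of_not h, smul_zero]
  | succ k ih =>
    by_cases h : ∃ S : {S // P S}, S.1.box = b
    · obtain ⟨S, rfl⟩ := h
      let i : Fin (n - 1) := ⟨k, by omega⟩
      have hne := S.1.qContent_low_ne_high hq hq0 i
      have h1 := offCoeff_mul_self_add (q := q) hne
      have hgen : gen n q k = T q i := (T_eq_gen i).symm
      have hlow : (⟨k, by omega⟩ : Fin n) = lowIndex i := rfl
      have hhigh : (⟨k + 1, hk⟩ : Fin n) = highIndex i := rfl
      rw [jm, hgen, hhigh, map_mul, map_mul, Module.End.mul_apply, Module.End.mul_apply]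
      simp only [seminormalRep_T, map_add, map_smul, ih (by omega), hlow, Function.comp_apply,
        simpleSwap_low, simpleSwap_high, comp_simpleSwap_self]
      rw [offCoeff_comm q (qContent q (S.1.box (highIndex i)))]
      generalize qContent q (S.1.box (lowIndex i)) = c at *
      generalize qContent q (S.1.box (highIndex i)) = d at *
      generalize offCoeff q c d = β at *
      have hdc : d - c ≠ 0 := sub_ne_zero.mpr hne.symm
      have hcd : c - d ≠ 0 := sub_ne_zero.mpr hne
      match_scalars
      · have h2 : c * (diagCoeff q c d * diagCoeff q c d) + d * (1 + (q - q⁻¹) * diagCoeff q c d -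
            diagCoeff q c d * diagCoeff q c d) = d := by
          rw [diagCoeff]
          generalize q - q⁻¹ = δ
          field_simp
          ring
        linear_combination h2 + d * h1
      · have h2 : diagCoeff q c d * c + diagCoeff q d c * d = 0 := by
          rw [diagCoeff, diagCoeff]
          generalize q - q⁻¹ = δ
          field_simp
          ring
        linear_combination β * h2
    · rw [vec_of_not h, map_zero, smul_zero]

/-- A vector on which the Jucys--Murphy elements act by the contents of `S`. -/
def IsWeightVector {W : Type*} [AddCommGroup W] [Module ℂ W]
    (σ : HeckeAlgebra n q →ₐ[ℂ] Module.End ℂ W) (S : StandardTableau n) (w : W) : Prop :=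
  ∀ k < n, σ (jm n q k) w = contentAt q S k • w

theorem isWeightVector_vec (hq : IsGenericUpTo n q) (hq0 : q ≠ 0) {P : StandardTableau n → Prop}
    (hP : RearrangementClosed P) (S : StandardTableau n) :
    IsWeightVector (seminormalRep hq hq0 hP) S (vec P S.box) := by
  intro k hk
  rw [seminormalRep_jm hq hq0 hP hk, contentAt, dif_pos hk, quantumContent_eq]

open Classical in
/-- The contents which occur at step `k`. -/
def contentSet (n : ℕ) (q : ℂ) (k : ℕ) : Finset ℂ :=
  Finset.univ.image fun S : StandardTableau n => contentAt q S k

theorem contentAt_mem (S : StandardTableau n) (k : ℕ) : contentAt q S k ∈ contentSet n q k :=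
  Finset.mem_image_of_mem _ (Finset.mem_univ S)

open Classical in
/-- The spectral projector of the `k`-th Jucys--Murphy element for the eigenvalue `a`. -/
def spectralProj (n : ℕ) (q : ℂ) (k : ℕ) (a : ℂ) : HeckeAlgebra n q :=
  aeval (jm n q k) (Lagrange.basis (contentSet n q k) id a)

theorem algHom_aeval_apply {A W : Type*} [Ring A] [Algebra ℂ A] [AddCommGroup W] [Module ℂ W]
    (σ : A →ₐ[ℂ] Module.End ℂ W) {y : A} {w : W} {c : ℂ} (h : σ y w = c • w) (p : ℂ[X]) :
    σ (aeval y p) w = p.eval c • w := by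
  induction p using Polynomial.induction_on' with
  | add p r hp hr => simp only [map_add, LinearMap.add_apply, hp, hr, eval_add, add_smul]
  | monomial m a =>
    have : ∀ m : ℕ, (σ y ^ m) w = c ^ m • w := by
      intro m
      induction m with
      | zero => simp
      | succ m ih =>
        rw [pow_succ', Module.End.mul_apply, ih, map_smul, h, smul_smul, pow_succ]
    rw [aeval_monomial, ← Algebra.smul_def, map_smul, map_pow, LinearMap.smul_apply, this,
      eval_monomial, smul_smul]

open Classical in
theorem IsWeightVector.spectralProj_apply {W : Type*} [AddCommGroup W] [Module ℂ W]
    {σ : HeckeAlgebra n q →ₐ[ℂ] Module.End ℂ W} {S : StandardTableau n} {w : W}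
    (h : IsWeightVector σ S w) {k : ℕ} (hk : k < n) {a : ℂ} (ha : a ∈ contentSet n q k) :
    σ (spectralProj n q k a) w = if contentAt q S k = a then w else 0 := by
  rw [spectralProj, algHom_aeval_apply σ (h k hk)]
  split_ifs with hS
  · have := Lagrange.eval_basis_self (v := id) (Function.injective_id.injOn) ha
    rw [id] at this
    rw [hS, this, one_smul]
  · have := Lagrange.eval_basis_of_ne (v := id) (i := a) (Ne.symm hS) (contentAt_mem S k)
    rw [id] at this
    rw [this, zero_smul]

/-- The product of the spectral projectors for the first `k` contents of `U`. -/
def partialIdempotent (q : ℂ) (U : StandardTableau n) : ℕ → HeckeAlgebra n q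
  | 0 => 1
  | k + 1 => partialIdempotent q U k * spectralProj n q k (contentAt q U k)

open Classical in
theorem IsWeightVector.partialIdempotent_apply {W : Type*} [AddCommGroup W] [Module ℂ W]
    {σ : HeckeAlgebra n q →ₐ[ℂ] Module.End ℂ W} {S : StandardTableau n} {w : W}
    (h : IsWeightVector σ S w) (U : StandardTableau n) {k : ℕ} (hk : k ≤ n) :
    σ (partialIdempotent q U k) w =
      if ∀ i < k, contentAt q S i = contentAt q U i then w else 0 := by
  induction k with
  | zero => simp [partialIdempotent]
  | succ k ih =>
    rw [partialIdempotent, map_mul, Module.End.mul_apply,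
      h.spectralProj_apply (by omega) (contentAt_mem U k)]
    split_ifs with h1 h2 h2
    · rw [ih (by omega), if_pos fun i hi => h2 i (by omega)]
    · rw [ih (by omega), if_neg]
      intro h3
      apply h2
      intro i hi
      rcases (show i < k ∨ i = k by omega) with h4 | rfl
      · exact h3 i h4
      · exact h1
    · exact absurd (h2 k (Nat.lt_succ_self k)) h1
    · exact map_zero _

/-- The idempotent of a standard tableau. -/
def tableauIdempotent (q : ℂ) (U : StandardTableau n) : HeckeAlgebra n q :=
  partialIdempotent q U n

open Classical in
theorem IsWeightVector.tableauIdempotent_apply (hq : IsGenericUpTo n q) (hq0 : q ≠ 0)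
    {W : Type*} [AddCommGroup W] [Module ℂ W]
    {σ : HeckeAlgebra n q →ₐ[ℂ] Module.End ℂ W} {S : StandardTableau n} {w : W}
    (h : IsWeightVector σ S w) (U : StandardTableau n) :
    σ (tableauIdempotent q U) w = if S = U then w else 0 := by
  rw [tableauIdempotent, h.partialIdempotent_apply U le_rfl]
  refine if_congr ?_ rfl rfl
  constructor
  · intro h'
    refine ext_of_quantumContent hq hq0 fun i => ?_
    rw [← contentAt_val, ← contentAt_val]
    exact h' i.val i.isLt
  · rintro rfl i _
    rfl

/-- The representation on the span of all standard tableaux. -/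
def totalRep (hq : IsGenericUpTo n q) (hq0 : q ≠ 0) : HeckeAlgebra n q →ₐ[ℂ]
    Module.End ℂ ({_S : StandardTableau n // True} →₀ ℂ) :=
  seminormalRep hq hq0 rearrangementClosed_true

/-- The vector of a tableau in the representation on all tableaux. -/
def totalVec (S : StandardTableau n) : {_S : StandardTableau n // True} →₀ ℂ :=
  Finsupp.single ⟨S, trivial⟩ 1

theorem vec_true (S : StandardTableau n) : vec (fun _ => True) S.box = totalVec S :=
  vec_box (P := fun _ => True) ⟨S, trivial⟩

theorem isWeightVector_totalVec (hq : IsGenericUpTo n q) (hq0 : q ≠ 0) (S : StandardTableau n) :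
    IsWeightVector (totalRep hq hq0) S (totalVec S) := by
  rw [← vec_true]
  exact isWeightVector_vec hq hq0 _ S

theorem totalVec_ne_zero (S : StandardTableau n) : totalVec S ≠ 0 := by
  rw [totalVec, Ne, Finsupp.single_eq_zero]
  exact one_ne_zero

open Classical in
theorem totalVec_apply (S U : StandardTableau n) :
    totalVec S ⟨U, trivial⟩ = if S = U then 1 else 0 := by
  rw [totalVec, Finsupp.single_apply]
  simp only [Subtype.mk.injEq]

open Classical in
-- The idempotent of `U` is the diagonal unit; the others arise by transport along a chain of
-- admissible exchanges, whose off-diagonal coefficients are invertible.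
theorem exists_matrixUnit (hq : IsGenericUpTo n q) (hq0 : q ≠ 0) {S U : StandardTableau n}
    (h : S.boxes = U.boxes) : ∃ m : HeckeAlgebra n q, ∀ X : StandardTableau n,
      totalRep hq hq0 m (totalVec X) = if X = U then totalVec S else 0 := by
  refine of_boxes_eq (P := fun S => ∃ m : HeckeAlgebra n q, ∀ X : StandardTableau n,
      totalRep hq hq0 m (totalVec X) = if X = U then totalVec S else 0) ?_ h.symm ?_
  · rintro S S' i hadm hS' ⟨m, hm⟩
    have hne := offCoeff_ne_zero_of_not_le hq hq0 S i hadm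
    have hSS' : S ≠ S' := by
      rintro rfl
      have := congrFun hS' (lowIndex i)
      rw [Function.comp_apply, simpleSwap_low] at this
      exact lowIndex_ne_highIndex i (S.injective this)
    -- `T_i v_S` has components along `v_S` and `v_{S'}` only; the idempotent of `S'` keeps the
    -- second, and the scalar normalises it.
    refine ⟨(offCoeff q (qContent q (S.box (lowIndex i))) (qContent q (S.box (highIndex i))))⁻¹ •
      (tableauIdempotent q S' * T q i * m), fun X => ?_⟩
    rw [map_smul, map_mul, map_mul, LinearMap.smul_apply, Module.End.mul_apply,
      Module.End.mul_apply, hm]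
    split_ifs with hX
    · have h1 : totalRep hq hq0 (T q i) (totalVec S) = _ :=
        vec_true S ▸ seminormalRep_T hq hq0 rearrangementClosed_true i S.box
      rw [h1, ← hS', map_add, map_smul, map_smul, vec_true,
        (isWeightVector_totalVec hq hq0 S).tableauIdempotent_apply hq hq0,
        (isWeightVector_totalVec hq hq0 S').tableauIdempotent_apply hq hq0, if_neg hSS',
        if_pos rfl, smul_zero, zero_add, smul_smul, inv_mul_cancel₀ hne, one_smul]
    · rw [map_zero, map_zero, smul_zero]
  · refine ⟨tableauIdempotent q U, fun X => ?_⟩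
    rw [(isWeightVector_totalVec hq hq0 X).tableauIdempotent_apply hq hq0]
    split_ifs with hX
    · rw [hX]
    · rfl

/-- The matrix coefficients of the representation on all tableaux, within each shape. -/
def matrixCoeff (hq : IsGenericUpTo n q) (hq0 : q ≠ 0) :
    HeckeAlgebra n q →ₗ[ℂ] (SameShapePair n → ℂ) where
  toFun h p := totalRep hq hq0 h (totalVec p.1.2) ⟨p.1.1, trivial⟩
  map_add' x y := by ext p; simp
  map_smul' a x := by ext p; simp

theorem matrixCoeff_surjective (hq : IsGenericUpTo n q) (hq0 : q ≠ 0) :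
    Function.Surjective (matrixCoeff hq hq0) := by
  classical
  intro f
  choose m hm using fun p : SameShapePair n => exists_matrixUnit hq hq0 p.2
  refine ⟨∑ p, f p • m p, ?_⟩
  rw [map_sum]
  ext p
  rw [Finset.sum_apply, Finset.sum_eq_single p]
  · rw [map_smul, Pi.smul_apply, matrixCoeff, LinearMap.coe_mk, AddHom.coe_mk, hm, if_pos rfl,
      totalVec_apply, if_pos rfl, smul_eq_mul, mul_one]
  · intro p' _ hp
    rw [map_smul, Pi.smul_apply, matrixCoeff, LinearMap.coe_mk, AddHom.coe_mk, hm]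
    split_ifs with h
    · rw [totalVec_apply, if_neg, smul_zero]
      intro h'
      exact hp (Subtype.ext (Prod.ext h' h.symm))
    · rw [Finsupp.zero_apply, smul_zero]
  · intro h
    exact absurd (Finset.mem_univ _) h

/-- A surjection onto a space of dimension `n!` from an algebra of dimension at most `n!` is
bijective. -/
theorem matrixCoeff_injective (hq : IsGenericUpTo n q) (hq0 : q ≠ 0) :
    Function.Injective (matrixCoeff hq hq0) := by
  have hs := matrixCoeff_surjective hq hq0
  have h1 : Module.finrank ℂ (SameShapePair n → ℂ) = n.factorial := by
    rw [Module.finrank_pi, ← Nat.card_eq_fintype_card, card_sameShapePair]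
  have h2 : Module.finrank ℂ (SameShapePair n → ℂ) ≤ Module.finrank ℂ (HeckeAlgebra n q) :=
    LinearMap.finrank_le_finrank_of_surjective hs
  rw [LinearMap.injective_iff_surjective_of_finrank_eq_finrank]
  · exact hs
  · exact le_antisymm ((finrank_le n q).trans h1.ge) h2

/-- Elements of the Hecke algebra are determined by their action on tableaux. -/
theorem ext_of_totalRep (hq : IsGenericUpTo n q) (hq0 : q ≠ 0) {x y : HeckeAlgebra n q}
    (h : ∀ S, totalRep hq hq0 x (totalVec S) = totalRep hq hq0 y (totalVec S)) : x = y := by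
  apply matrixCoeff_injective hq hq0
  ext p
  exact congrArg (fun w : {_S : StandardTableau n // True} →₀ ℂ => w ⟨p.1.1, trivial⟩) (h p.1.2)

/-- The inclusion of the span of a class of tableaux into the span of all tableaux. -/
def inclusion (P : StandardTableau n → Prop) :
    ({S // P S} →₀ ℂ) →ₗ[ℂ] ({_S : StandardTableau n // True} →₀ ℂ) :=
  Finsupp.lmapDomain ℂ ℂ fun S => ⟨S.1, trivial⟩

theorem inclusion_injective (P : StandardTableau n → Prop) :
    Function.Injective (inclusion P) :=
  Finsupp.mapDomain_injective fun _ _ h =>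
    Subtype.ext (congrArg (fun X : {_S : StandardTableau n // True} => X.1) h)

theorem inclusion_single {P : StandardTableau n → Prop} (S : {S // P S}) :
    inclusion P (Finsupp.single S 1) = totalVec S.1 := by
  rw [inclusion, Finsupp.lmapDomain_apply, Finsupp.mapDomain_single, totalVec]

/-- Elements with the intertwining property form a subspace closed under right multiplication by
generators, so generators suffice. For them, an exchanged filling that is not standard gives the
zero vector in both spaces. -/
theorem inclusion_apply_seminormalRep (hq : IsGenericUpTo n q) (hq0 : q ≠ 0)
    {P : StandardTableau n → Prop} (hP : RearrangementClosed P) (h : HeckeAlgebra n q)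
    (x : {S // P S} →₀ ℂ) :
    inclusion P (seminormalRep hq hq0 hP h x) = totalRep hq hq0 h (inclusion P x) := by
  have hT : ∀ i, inclusion P ∘ₗ seminormalRep hq hq0 hP (T q i) =
      totalRep hq hq0 (T q i) ∘ₗ inclusion P := by
    intro i
    refine end_ext fun S => ?_
    rw [LinearMap.comp_apply, LinearMap.comp_apply, seminormalRep_T, vec_box, inclusion_single,
      ← vec_true, totalRep, seminormalRep_T, map_add, map_smul, map_smul, inclusion_single,
      ← vec_true]
    congr 2
    by_cases hS : S.1.box (lowIndex i) ≤ S.1.box (highIndex i)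
    · have h1 : ∀ S' : StandardTableau n, S'.box ≠ S.1.box ∘ simpleSwap i := by
        intro S' hS'
        have h2 : S'.box (highIndex i) ≤ S'.box (lowIndex i) := by
          rw [hS', Function.comp_apply, Function.comp_apply, simpleSwap_low, simpleSwap_high]
          exact hS
        have := S'.le_of_box_le h2
        simp only [lowIndex, highIndex, Fin.le_def] at this
        omega
      rw [vec_of_not fun ⟨S', h'⟩ => h1 S'.1 h', vec_of_not fun ⟨S', h'⟩ => h1 S'.1 h', map_zero]
    · obtain ⟨S', hS'⟩ := S.1.exists_box_eq_comp_simpleSwap i hS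
      rw [← hS', vec_true]
      have := vec_box (P := P) ⟨S', hP _ _ _ hS' S.2⟩
      rw [this, inclusion_single]
  let N : Submodule ℂ (HeckeAlgebra n q) :=
    { carrier := {h | ∀ x, inclusion P (seminormalRep hq hq0 hP h x) =
        totalRep hq hq0 h (inclusion P x)}
      add_mem' := fun {a b} ha hb x => by
        rw [map_add, map_add, LinearMap.add_apply, LinearMap.add_apply, map_add, ha, hb]
      zero_mem' := fun x => by simp
      smul_mem' := fun c a ha x => by
        rw [map_smul, map_smul, LinearMap.smul_apply, LinearMap.smul_apply, map_smul, ha] }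
  have hN : N = ⊤ := by
    refine submodule_eq_top N (fun x => by simp) fun a ha i x => ?_
    rw [map_mul, map_mul, Module.End.mul_apply, Module.End.mul_apply, ha]
    exact congrArg _ (LinearMap.congr_fun (hT i) x)
  have : h ∈ N := hN ▸ Submodule.mem_top
  exact this x

/-- The matrix unit taking `v_U` to `v_S`. -/
def matrixUnit (hq : IsGenericUpTo n q) (hq0 : q ≠ 0) {S U : StandardTableau n}
    (h : S.boxes = U.boxes) : HeckeAlgebra n q := (exists_matrixUnit hq hq0 h).choose

open Classical in
theorem matrixUnit_apply (hq : IsGenericUpTo n q) (hq0 : q ≠ 0) {S U : StandardTableau n}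
    (h : S.boxes = U.boxes) (X : StandardTableau n) :
    totalRep hq hq0 (matrixUnit hq hq0 h) (totalVec X) = if X = U then totalVec S else 0 :=
  (exists_matrixUnit hq hq0 h).choose_spec X

theorem matrixUnit_self (hq : IsGenericUpTo n q) (hq0 : q ≠ 0) (U : StandardTableau n) :
    matrixUnit hq hq0 (rfl : U.boxes = U.boxes) = tableauIdempotent q U := by
  classical
  refine ext_of_totalRep hq hq0 fun X => ?_
  rw [matrixUnit_apply, (isWeightVector_totalVec hq hq0 X).tableauIdempotent_apply hq hq0]
  split_ifs with h
  · rw [h]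
  · rfl

/-! ### Irreducible representations by shape; uniqueness and primitivity of the idempotents. -/

/-- The seminormal representation of a given shape. -/
def shapeRep (hq : IsGenericUpTo n q) (hq0 : q ≠ 0) (lam : YoungDiagram) :
    HeckeAlgebra n q →ₐ[ℂ] Module.End ℂ (TableauSpace n lam) :=
  seminormalRep hq hq0 (rearrangementClosed_shape lam)

theorem isWeightVector_single (hq : IsGenericUpTo n q) (hq0 : q ≠ 0) {lam : YoungDiagram}
    (S : {S : StandardTableau n // S.shape = lam}) :
    IsWeightVector (shapeRep hq hq0 lam) S.1 (Finsupp.single S 1) := by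
  rw [← vec_box S]
  exact isWeightVector_vec hq hq0 _ S.1

open Classical in
theorem shapeRep_tableauIdempotent (hq : IsGenericUpTo n q) (hq0 : q ≠ 0) {lam : YoungDiagram}
    (S : {S : StandardTableau n // S.shape = lam}) (x : TableauSpace n lam) :
    shapeRep hq hq0 lam (tableauIdempotent q S.1) x = x S • Finsupp.single S 1 := by
  suffices H : shapeRep hq hq0 lam (tableauIdempotent q S.1) =
      (Finsupp.lapply S).smulRight (Finsupp.single S 1) by
    rw [H]; rfl
  refine Finsupp.lhom_ext' fun X => LinearMap.ext_ring ?_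
  rw [LinearMap.comp_apply, LinearMap.comp_apply, Finsupp.lsingle_apply,
    (isWeightVector_single hq hq0 X).tableauIdempotent_apply hq hq0, LinearMap.smulRight_apply,
    Finsupp.lapply_apply, Finsupp.single_apply]
  by_cases h : X = S
  · rw [if_pos h, if_pos (congrArg Subtype.val h), h, one_smul]
  · rw [if_neg h, if_neg (fun h' => h (Subtype.ext h')), zero_smul]

/-- The idempotents cut a basis vector out of any nonzero vector of an invariant subspace, and the
matrix units reach all the others from it. -/
theorem isIrreducibleRep_shapeRep (hq : IsGenericUpTo n q) (hq0 : q ≠ 0)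
    (U : StandardTableau n) : IsIrreducibleRep (shapeRep hq hq0 U.shape) := by
  classical
  refine ⟨⟨Finsupp.single ⟨U, rfl⟩ 1, 0, by simp⟩, fun W hW => ?_⟩
  by_cases hbot : W = ⊥
  · exact Or.inl hbot
  right
  obtain ⟨w, hw, hw0⟩ := W.exists_mem_ne_zero_of_ne_bot hbot
  obtain ⟨S, hS⟩ := Finsupp.ne_iff.mp hw0
  rw [Finsupp.zero_apply] at hS
  have hSW : Finsupp.single S 1 ∈ W := by
    have h1 := hW (tableauIdempotent q S.1) w hw
    rw [shapeRep_tableauIdempotent] at h1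
    have h2 := W.smul_mem (w S)⁻¹ h1
    rwa [smul_smul, inv_mul_cancel₀ hS, one_smul] at h2
  have hall : ∀ S' : {S' : StandardTableau n // S'.shape = U.shape}, Finsupp.single S' 1 ∈ W := by
    intro S'
    have hb : S'.1.boxes = S.1.boxes := shape_eq_iff.mp (S'.2.trans S.2.symm)
    have h1 := hW (matrixUnit hq hq0 hb) _ hSW
    have h2 : shapeRep hq hq0 U.shape (matrixUnit hq hq0 hb) (Finsupp.single S 1) =
        Finsupp.single S' 1 := by
      apply inclusion_injective
      rw [shapeRep, inclusion_apply_seminormalRep, inclusion_single, inclusion_single,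
        matrixUnit_apply, if_pos rfl]
    rwa [h2] at h1
  rw [eq_top_iff]
  rintro x -
  induction x using Finsupp.induction_linear with
  | zero => exact W.zero_mem
  | add x y hx hy => exact W.add_mem hx hy
  | single S' a =>
    have := W.smul_mem a (hall S')
    rwa [Finsupp.smul_single, smul_eq_mul, mul_one] at this

theorem isTableauRep_shapeRep (hq : IsGenericUpTo n q) (hq0 : q ≠ 0) (U : StandardTableau n) :
    IsTableauRep q U.shape (shapeRep hq hq0 U.shape) where
  irreducible := isIrreducibleRep_shapeRep hq hq0 U
  jucysMurphy_apply S j := by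
    rw [jucysMurphy_eq_jm, isWeightVector_single hq hq0 S j.val j.isLt, contentAt_val]

/-- The embedding of a seminormal representation as a left ideal. -/
def idealMap (hq : IsGenericUpTo n q) (hq0 : q ≠ 0) (U : StandardTableau n) :
    TableauSpace n U.shape →ₗ[ℂ] HeckeAlgebra n q :=
  Finsupp.linearCombination ℂ fun S => matrixUnit hq hq0 (shape_eq_iff.mp S.2)

/-- The element `idealMap x` sends `v_U` to `x` and kills the other tableau vectors; faithfulness
turns this description into the intertwining property. -/
theorem idealMap_shapeRep (hq : IsGenericUpTo n q) (hq0 : q ≠ 0) (U : StandardTableau n)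
    (h : HeckeAlgebra n q) (x : TableauSpace n U.shape) :
    idealMap hq hq0 U (shapeRep hq hq0 U.shape h x) = h * idealMap hq hq0 U x := by
  classical
  have key : ∀ (x : TableauSpace n U.shape) (X : StandardTableau n),
      totalRep hq hq0 (idealMap hq hq0 U x) (totalVec X) =
        if X = U then inclusion _ x else 0 := by
    intro x X
    induction x using Finsupp.induction_linear with
    | zero => simp
    | add x y hx hy =>
      rw [map_add, map_add, LinearMap.add_apply, hx, hy, map_add]
      split_ifs <;> simp
    | single S a =>
      have h1 : Finsupp.single S a = a • Finsupp.single S (1 : ℂ) := by simp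
      rw [h1, map_smul, map_smul, LinearMap.smul_apply, map_smul, inclusion_single, idealMap,
        Finsupp.linearCombination_single, one_smul, matrixUnit_apply]
      split_ifs <;> simp
  refine ext_of_totalRep hq hq0 fun X => ?_
  rw [map_mul, Module.End.mul_apply, key, key]
  split_ifs
  · rw [shapeRep, inclusion_apply_seminormalRep]
  · rw [map_zero]

/-- An irreducible representation not killed by the idempotent of `U` is the seminormal one. -/
theorem isoRep_of_tableauIdempotent_ne_zero (hq : IsGenericUpTo n q) (hq0 : q ≠ 0)
    (U : StandardTableau n) {W : Type*} [AddCommGroup W] [Module ℂ W]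
    (σ : HeckeAlgebra n q →ₐ[ℂ] Module.End ℂ W) (hσ : IsIrreducibleRep σ)
    (h : σ (tableauIdempotent q U) ≠ 0) : IsoRep (shapeRep hq hq0 U.shape) σ := by
  obtain ⟨w, hw⟩ : ∃ w, σ (tableauIdempotent q U) w ≠ 0 := by
    by_contra hall
    push Not at hall
    exact h (LinearMap.ext hall)
  -- The left ideal of `E_U` acts on a vector `w` not killed by `E_U`. Schur's argument with kernel
  -- and range makes the resulting intertwiner an isomorphism.
  let f : TableauSpace n U.shape →ₗ[ℂ] W :=
    (LinearMap.applyₗ w) ∘ₗ σ.toLinearMap ∘ₗ idealMap hq hq0 U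
  have hf : ∀ a v, f (shapeRep hq hq0 U.shape a v) = σ a (f v) := by
    intro a v
    change σ (idealMap hq hq0 U (shapeRep hq hq0 U.shape a v)) w = σ a (σ (idealMap hq hq0 U v) w)
    rw [idealMap_shapeRep, map_mul, Module.End.mul_apply]
  have hfU : f (Finsupp.single ⟨U, rfl⟩ 1) ≠ 0 := by
    have : f (Finsupp.single ⟨U, rfl⟩ 1) = σ (tableauIdempotent q U) w := by
      change σ (idealMap hq hq0 U (Finsupp.single ⟨U, rfl⟩ 1)) w = _
      rw [idealMap, Finsupp.linearCombination_single, one_smul, ← matrixUnit_self hq hq0]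
    rw [this]
    exact hw
  have hker : LinearMap.ker f = ⊥ := by
    refine ((isIrreducibleRep_shapeRep hq hq0 U).2 _ fun a v hv => ?_).resolve_right ?_
    · rw [LinearMap.mem_ker] at hv ⊢
      rw [hf, hv, map_zero]
    · intro htop
      apply hfU
      rw [← LinearMap.mem_ker, htop]
      exact Submodule.mem_top
  have hrange : LinearMap.range f = ⊤ := by
    refine (hσ.2 _ fun a v hv => ?_).resolve_left ?_
    · obtain ⟨x, rfl⟩ := hv
      exact ⟨shapeRep hq hq0 U.shape a x, hf a x⟩
    · intro hbot
      apply hfU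
      rw [← Submodule.mem_bot ℂ, ← hbot]
      exact LinearMap.mem_range_self f _
  exact ⟨LinearEquiv.ofBijective f ⟨LinearMap.ker_eq_bot.mp hker, LinearMap.range_eq_top.mp hrange⟩,
    hf⟩

theorem isTableauIdempotent_tableauIdempotent (hq : IsGenericUpTo n q) (hq0 : q ≠ 0)
    (U : StandardTableau n) : IsTableauIdempotent q U (tableauIdempotent q U) := by
  classical
  refine ⟨shapeRep hq hq0 U.shape, isTableauRep_shapeRep hq hq0 U, ?_, ?_, ?_⟩
  · rw [(isWeightVector_single hq hq0 ⟨U, rfl⟩).tableauIdempotent_apply hq hq0, if_pos rfl]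
  · intro S hS
    rw [(isWeightVector_single hq hq0 S).tableauIdempotent_apply hq hq0, if_neg hS]
  · intro W _ _ σ hσ hiso
    by_contra h
    exact hiso (isoRep_of_tableauIdempotent_ne_zero hq hq0 U σ hσ h)

/-- The representation `ρ` in the definition need not be the seminormal one, but its weight vectors
force `E_U` to act on it without vanishing, so the two are isomorphic. Thus `e` and `E_U` agree on
the shape of `U`, both vanish on other shapes, and faithfulness concludes. -/
theorem eq_tableauIdempotent (hq : IsGenericUpTo n q) (hq0 : q ≠ 0)
    (U : StandardTableau n) {e : HeckeAlgebra n q} (he : IsTableauIdempotent q U e) :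
    e = tableauIdempotent q U := by
  classical
  obtain ⟨ρ, hρ, h1, h2, h3⟩ := he
  have hwt : ∀ S : {S : StandardTableau n // S.shape = U.shape},
      IsWeightVector ρ S.1 (Finsupp.single S 1) := by
    intro S k hk
    have := hρ.jucysMurphy_apply S ⟨k, hk⟩
    rw [jucysMurphy_eq_jm] at this
    rw [this, contentAt, dif_pos hk]
  have hρe : ρ e = ρ (tableauIdempotent q U) := by
    refine Finsupp.lhom_ext' fun S => LinearMap.ext_ring ?_
    rw [LinearMap.comp_apply, LinearMap.comp_apply, Finsupp.lsingle_apply,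
      (hwt S).tableauIdempotent_apply hq hq0]
    split_ifs with h
    · obtain ⟨S, hS⟩ := S
      obtain rfl : S = U := h
      exact h1
    · exact h2 S h
  have hρ0 : ρ (tableauIdempotent q U) ≠ 0 := by
    intro h0
    have := (hwt ⟨U, rfl⟩).tableauIdempotent_apply hq hq0 U
    rw [h0, if_pos rfl, LinearMap.zero_apply, eq_comm, Finsupp.single_eq_zero] at this
    exact one_ne_zero this
  obtain ⟨f, hf⟩ := isoRep_of_tableauIdempotent_ne_zero hq hq0 U ρ hρ.irreducible hρ0
  refine ext_of_totalRep hq hq0 fun X => ?_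
  by_cases hX : X.shape = U.shape
  · rw [← inclusion_single (P := fun S => S.shape = U.shape) ⟨X, hX⟩,
      ← inclusion_apply_seminormalRep hq hq0 (rearrangementClosed_shape U.shape),
      ← inclusion_apply_seminormalRep hq hq0 (rearrangementClosed_shape U.shape)]
    congr 1
    apply f.injective
    exact (hf _ _).trans ((LinearMap.congr_fun hρe _).trans (hf _ _).symm)
  · have hne : ∀ S : {S : StandardTableau n // S.shape = X.shape}, S.1 ≠ U := by
      rintro ⟨S, hS⟩ rfl
      exact hX hS.symm
    have hzero : shapeRep hq hq0 X.shape (tableauIdempotent q U) = 0 := by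
      refine Finsupp.lhom_ext' fun S => LinearMap.ext_ring ?_
      rw [LinearMap.comp_apply, Finsupp.lsingle_apply,
        (isWeightVector_single hq hq0 S).tableauIdempotent_apply hq hq0, if_neg (hne S)]
      rfl
    have he0 : shapeRep hq hq0 X.shape e = 0 := by
      -- `E_U` acts by zero on the shape of `X` but not under `ρ`, so the two representations are
      -- not isomorphic.
      refine h3 _ _ (isIrreducibleRep_shapeRep hq hq0 X) ?_
      rintro ⟨g, hg⟩
      apply hρ0
      ext1 v
      apply LinearMap.ext
      intro
      apply g.injective
      rw [LinearMap.comp_apply, hg, hzero]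
      simp
    rw [← inclusion_single (P := fun S => S.shape = X.shape) ⟨X, rfl⟩,
      ← inclusion_apply_seminormalRep hq hq0 (rearrangementClosed_shape X.shape),
      ← inclusion_apply_seminormalRep hq hq0 (rearrangementClosed_shape X.shape)]
    congr 1
    exact (LinearMap.congr_fun he0 _).trans (LinearMap.congr_fun hzero _).symm

/-- `E_U` has rank one in a faithful representation, so its corner algebra consists of scalars; this
yields primitivity. -/
theorem tableauIdempotent_mul_mul (hq : IsGenericUpTo n q) (hq0 : q ≠ 0)
    (U : StandardTableau n) (h : HeckeAlgebra n q) : ∃ a : ℂ,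
    tableauIdempotent q U * h * tableauIdempotent q U = a • tableauIdempotent q U := by
  classical
  have hproj : ∀ x, ∃ b : ℂ, totalRep hq hq0 (tableauIdempotent q U) x = b • totalVec U := by
    intro x
    induction x using Finsupp.induction_linear with
    | zero => exact ⟨0, by simp⟩
    | add x y hx hy =>
      obtain ⟨b, hb⟩ := hx
      obtain ⟨c, hc⟩ := hy
      exact ⟨b + c, by rw [map_add, hb, hc, add_smul]⟩
    | single X a =>
      have h1 : Finsupp.single X a = a • totalVec X.1 := by simp [totalVec]
      rw [h1, map_smul, (isWeightVector_totalVec hq hq0 X.1).tableauIdempotent_apply hq hq0]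
      split_ifs with hX
      · exact ⟨a, by rw [hX]⟩
      · exact ⟨0, by simp⟩
  obtain ⟨a, ha⟩ := hproj (totalRep hq hq0 h (totalVec U))
  refine ⟨a, ext_of_totalRep hq hq0 fun X => ?_⟩
  rw [map_mul, map_mul, Module.End.mul_apply, Module.End.mul_apply, map_smul, LinearMap.smul_apply,
    (isWeightVector_totalVec hq hq0 X).tableauIdempotent_apply hq hq0]
  split_ifs with hX
  · rw [hX, ha]
  · rw [map_zero, map_zero, smul_zero]

theorem tableauIdempotent_ne_zero (hq : IsGenericUpTo n q) (hq0 : q ≠ 0)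
    (U : StandardTableau n) : tableauIdempotent q U ≠ 0 := by
  classical
  intro h
  have := (isWeightVector_totalVec hq hq0 U).tableauIdempotent_apply hq hq0 U
  rw [h, if_pos rfl, map_zero, LinearMap.zero_apply] at this
  exact totalVec_ne_zero U this.symm

theorem isIdempotentElem_tableauIdempotent (hq : IsGenericUpTo n q) (hq0 : q ≠ 0)
    (U : StandardTableau n) : IsIdempotentElem (tableauIdempotent q U) := by
  classical
  refine ext_of_totalRep hq hq0 fun X => ?_
  rw [map_mul, Module.End.mul_apply,
    (isWeightVector_totalVec hq hq0 X).tableauIdempotent_apply hq hq0]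
  split_ifs with hX
  · rw [(isWeightVector_totalVec hq hq0 X).tableauIdempotent_apply hq hq0, if_pos hX]
  · rw [map_zero]

theorem isPrimitiveIdempotent_tableauIdempotent (hq : IsGenericUpTo n q) (hq0 : q ≠ 0)
    (U : StandardTableau n) : IsPrimitiveIdempotent (tableauIdempotent q U) := by
  have h0 := tableauIdempotent_ne_zero hq hq0 U
  refine ⟨isIdempotentElem_tableauIdempotent hq hq0 U, h0, fun f g hf hg hfg hgf he => ?_⟩
  obtain ⟨a, ha⟩ := tableauIdempotent_mul_mul hq hq0 U f
  -- Orthogonality of the summands gives `f = E_U f E_U`.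
  have hfa : f = a • tableauIdempotent q U := by
    rw [← ha, he, add_mul, hgf, add_zero, hf.eq, mul_add, hf.eq, hfg, add_zero]
  have haa : a * a = a := by
    have h1 := hf.eq
    rw [hfa, smul_mul_smul_comm, (isIdempotentElem_tableauIdempotent hq hq0 U).eq] at h1
    exact smul_left_injective ℂ h0 h1
  rcases (show a = 0 ∨ a = 1 by rw [← sub_eq_zero (a := a) (b := 1), ← mul_eq_zero]; linear_combination haa) with rfl | rfl
  · left; rw [hfa, zero_smul]
  · right
    rw [one_smul] at hfa
    rw [hfa] at he
    simpa using he

end HeckeAlgebra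

/-! ### Calculus of evaluations of algebra-valued rational functions. -/

section Evaluation

variable {A : Type*} [Ring A] [Algebra ℂ A]

/-- Evaluation of polynomials at scalars as a ring homomorphism. -/
def scalarEval (A : Type*) [Ring A] [Algebra ℂ A] (t : ℂ) : A[X] →+* A :=
  -- Scalars are central, so evaluation there is multiplicative although `A` need not be
  -- commutative.
  Polynomial.eval₂RingHom' (RingHom.id A) (algebraMap ℂ A t) fun x => (Algebra.commutes t x).symm

theorem scalarEval_apply (t : ℂ) (P : A[X]) : scalarEval A t P = P.eval (algebraMap ℂ A t) := rfl

theorem EvaluatesTo.congr {f g : ℂ → A} {a : ℂ} {x : A} (h : EvaluatesTo f a x)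
    (hfg : ∀ᶠ t in Filter.cofinite, g t = f t) : EvaluatesTo g a x := by
  obtain ⟨P, d, h1, h2, h3⟩ := h
  refine ⟨P, d, h1, ?_, h3⟩
  filter_upwards [h2, hfg] with t ht ht'
  rw [ht', ht]

theorem evaluatesTo_const (x : A) (a : ℂ) : EvaluatesTo (fun _ => x) a x :=
  ⟨C x, 1, by simp, by simp, by simp⟩

theorem EvaluatesTo.mul {f g : ℂ → A} {a : ℂ} {x y : A} (hf : EvaluatesTo f a x)
    (hg : EvaluatesTo g a y) : EvaluatesTo (fun t => f t * g t) a (x * y) := by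
  obtain ⟨P, d, h1, h2, h3⟩ := hf
  obtain ⟨P', d', h1', h2', h3'⟩ := hg
  refine ⟨P * P', d * d', by rw [eval_mul]; exact mul_ne_zero h1 h1', ?_, ?_⟩
  · filter_upwards [h2, h2'] with t ht ht'
    rw [← scalarEval_apply, map_mul, scalarEval_apply, scalarEval_apply, ← ht, ← ht', eval_mul,
      smul_mul_smul_comm]
  · rw [← scalarEval_apply, map_mul, scalarEval_apply, scalarEval_apply, ← h3, ← h3', eval_mul,
      smul_mul_smul_comm]

theorem EvaluatesTo.add {f g : ℂ → A} {a : ℂ} {x y : A} (hf : EvaluatesTo f a x)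
    (hg : EvaluatesTo g a y) : EvaluatesTo (fun t => f t + g t) a (x + y) := by
  obtain ⟨P, d, h1, h2, h3⟩ := hf
  obtain ⟨P', d', h1', h2', h3'⟩ := hg
  have key : ∀ t, (P * d'.map (algebraMap ℂ A) + P' * d.map (algebraMap ℂ A)).eval
      (algebraMap ℂ A t) = d'.eval t • P.eval (algebraMap ℂ A t) +
        d.eval t • P'.eval (algebraMap ℂ A t) := by
    intro t
    rw [← scalarEval_apply, map_add, map_mul, map_mul]
    simp only [scalarEval_apply, eval_map_algebraMap, aeval_algebraMap_apply_eq_algebraMap_eval,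
      ← Algebra.commutes, ← Algebra.smul_def]
  refine ⟨P * d'.map (algebraMap ℂ A) + P' * d.map (algebraMap ℂ A), d * d',
    by rw [eval_mul]; exact mul_ne_zero h1 h1', ?_, ?_⟩
  · filter_upwards [h2, h2'] with t ht ht'
    rw [key, ← ht, ← ht', eval_mul, smul_add, smul_smul, smul_smul, mul_comm (d'.eval t)]
  · rw [key, ← h3, ← h3', eval_mul, smul_add, smul_smul, smul_smul, mul_comm (d'.eval a)]

theorem evaluatesTo_div_smul (p d : ℂ[X]) {a : ℂ} (hd : d.eval a ≠ 0) (x : A) :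
    EvaluatesTo (fun t => (p.eval t / d.eval t) • x) a ((p.eval a / d.eval a) • x) := by
  have key : ∀ t, (C x * p.map (algebraMap ℂ A)).eval (algebraMap ℂ A t) = p.eval t • x := by
    intro t
    rw [← scalarEval_apply, map_mul]
    simp only [scalarEval_apply, eval_map_algebraMap, aeval_algebraMap_apply_eq_algebraMap_eval,
      ← Algebra.commutes, ← Algebra.smul_def, eval_C]
  have hd0 : d ≠ 0 := by rintro rfl; simp at hd
  refine ⟨C x * p.map (algebraMap ℂ A), d, hd, ?_, ?_⟩
  · have : ∀ᶠ t in Filter.cofinite, d.eval t ≠ 0 := by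
      rw [Filter.eventually_cofinite]
      refine (d.roots.toFinset.finite_toSet).subset fun t ht => ?_
      simpa [hd0] using ht
    filter_upwards [this] with t ht
    rw [key, smul_smul, mul_div_cancel₀ _ ht]
  · rw [key, smul_smul, mul_div_cancel₀ _ hd]

theorem evaluatesTo_sum {ι : Type*} (s : Finset ι) {f : ι → ℂ → A} {a : ℂ} {x : ι → A}
    (h : ∀ i ∈ s, EvaluatesTo (f i) a (x i)) :
    EvaluatesTo (fun t => ∑ i ∈ s, f i t) a (∑ i ∈ s, x i) := by
  classical
  induction s using Finset.induction_on with
  | empty => simpa using evaluatesTo_const (0 : A) a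
  | insert i s hi ih =>
    simp only [Finset.sum_insert hi]
    exact (h i (Finset.mem_insert_self i s)).add
      (ih fun j hj => h j (Finset.mem_insert_of_mem hj))

open HeckeAlgebra in
theorem evaluatesTo_ascProd {j : ℕ} {f : ℂ → Fin j → A} {a : ℂ} {x : Fin j → A}
    (h : ∀ k, EvaluatesTo (fun t => f t k) a (x k)) :
    EvaluatesTo (fun t => ascProd (f t)) a (ascProd x) := by
  induction j with
  | zero => simpa only [ascProd_zero] using evaluatesTo_const (1 : A) a
  | succ j ih =>
    simp only [ascProd_succ]
    exact (ih fun k => h k.castSucc).mul (h (Fin.last j))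

open HeckeAlgebra in
theorem evaluatesTo_descProd {j : ℕ} {f : ℂ → Fin j → A} {a : ℂ} {x : Fin j → A}
    (h : ∀ k, EvaluatesTo (fun t => f t k) a (x k)) :
    EvaluatesTo (fun t => descProd (f t)) a (descProd x) := by
  induction j with
  | zero => simpa only [descProd_zero] using evaluatesTo_const (1 : A) a
  | succ j ih =>
    simp only [descProd_succ]
    exact (h (Fin.last j)).mul (ih fun k => h k.castSucc)

open HeckeAlgebra in
theorem ascProd_succ' {M : Type*} [Monoid M] {j : ℕ} (f : Fin (j + 1) → M) :
    ascProd f = f 0 * ascProd (fun k : Fin j => f k.succ) := by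
  rw [ascProd, List.ofFn_succ, List.prod_cons]
  rfl

open HeckeAlgebra in
/-- Consecutive evaluation of an ordered product whose successive partial products evaluate
to `e 1`, `e 2`, …. -/
theorem consecutivelyEvaluatesTo_ascProd {n : ℕ} (Z : Fin n → (Fin n → ℂ) → A) (a : Fin n → ℂ)
    (e : ℕ → A) (B : Finset ℂ)
    (hreg : ∀ k j : Fin n, k < j → ∀ u : Fin n → ℂ, (∀ i < k, u i = a i) →
      (∀ i, k < i → u i ∉ B) →
      EvaluatesTo (fun t => Z j (Function.update u k t)) (a k) (Z j (Function.update u k (a k))))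
    (hmain : ∀ (k : Fin n) (u : Fin n → ℂ), (∀ i < k, u i = a i) →
      EvaluatesTo (fun t => e k.val * Z k (Function.update u k t)) (a k) (e (k.val + 1))) :
    ConsecutivelyEvaluatesTo (fun u => e 0 * ascProd fun j => Z j u) a (e n) := by
  induction n generalizing e with
  | zero => simp [ConsecutivelyEvaluatesTo, ascProd_zero]
  | succ n ih =>
    refine ⟨fun u => e 1 * ascProd fun j : Fin n => Z j.succ (Fin.cons (a 0) u),
      -- This polynomial is nonzero at `u` exactly when all remaining variables avoid `B`.
      ⟨∏ j, ∏ b ∈ B, (MvPolynomial.X j - MvPolynomial.C b), ?_, ?_⟩, ?_⟩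
    · refine Finset.prod_ne_zero_iff.mpr fun j _ => Finset.prod_ne_zero_iff.mpr fun b _ => ?_
      intro h
      have := congrArg (MvPolynomial.eval fun _ => b + 1) h
      simp at this
    · intro u hu
      have hu' : ∀ i, u i ∉ B := by
        intro i hi
        apply hu
        rw [map_prod]
        refine Finset.prod_eq_zero (Finset.mem_univ i) ?_
        rw [map_prod]
        exact Finset.prod_eq_zero hi (by simp)
      have hcons : ∀ t, Function.update (Fin.cons 0 u : Fin (n + 1) → ℂ) 0 t = Fin.cons t u :=
        fun t => Fin.update_cons_zero _ _ _
      simp only [ascProd_succ', ← mul_assoc]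
      have h0 := hmain 0 (Fin.cons 0 u) fun i hi => absurd hi (Fin.not_lt_zero i)
      simp only [hcons] at h0
      refine h0.mul (evaluatesTo_ascProd fun j => ?_)
      have h1 := hreg 0 j.succ (Fin.succ_pos j) (Fin.cons 0 u)
        (fun i hi => absurd hi (Fin.not_lt_zero i)) (by
          intro i hi
          induction i using Fin.cases with
          | zero => exact absurd hi (lt_irrefl _)
          | succ i => rw [Fin.cons_succ]; exact hu' i)
      simpa only [hcons] using h1
    · refine ih (fun j u => Z j.succ (Fin.cons (a 0) u)) (Fin.tail a) (fun k => e (k + 1)) ?_ ?_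
      · intro k j hkj u h1 h2
        simp only [Fin.cons_update]
        refine hreg k.succ j.succ (Fin.succ_lt_succ_iff.mpr hkj) (Fin.cons (a 0) u) ?_ ?_
        · intro i hi
          induction i using Fin.cases with
          | zero => rw [Fin.cons_zero]
          | succ i => rw [Fin.cons_succ]; exact h1 i (Fin.succ_lt_succ_iff.mp hi)
        · intro i hi
          induction i using Fin.cases with
          | zero => exact absurd hi (Fin.not_lt_zero _)
          | succ i => rw [Fin.cons_succ]; exact h2 i (Fin.succ_lt_succ_iff.mp hi)
      · intro k u h1
        simp only [Fin.cons_update]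
        refine hmain k.succ (Fin.cons (a 0) u) ?_
        intro i hi
        induction i using Fin.cases with
        | zero => rw [Fin.cons_zero]
        | succ i => rw [Fin.cons_succ]; exact h1 i (Fin.succ_lt_succ_iff.mp hi)

end Evaluation

/-! ### Inverses and regularity of the baxterized elements. -/

namespace HeckeAlgebra

variable {n : ℕ} {q : ℂ}

/-- Up to sign the second factor is the conjugate of the first under `T ↦ δ - T`, so the product is
a scalar norm. -/
theorem add_mul_sub_of_quad {A : Type*} [Ring A] [Algebra ℂ A] {T : A} {δ : ℂ}
    (hT : T * T = 1 + δ • T) (x : ℂ) :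
    (T + algebraMap ℂ A x) * (T - algebraMap ℂ A (δ + x)) = (1 - δ * x - x ^ 2) • 1 ∧
    (T - algebraMap ℂ A (δ + x)) * (T + algebraMap ℂ A x) = (1 - δ * x - x ^ 2) • 1 := by
  simp only [Algebra.algebraMap_eq_smul_one, add_mul, mul_add, sub_mul, mul_sub, hT,
    smul_mul_assoc, mul_smul_comm, one_mul, mul_one]
  constructor <;> module

theorem inverse_of_quad {A : Type*} [Ring A] [Algebra ℂ A] {T : A} {δ : ℂ}
    (hT : T * T = 1 + δ • T) {x : ℂ} (hx : 1 - δ * x - x ^ 2 ≠ 0) :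
    IsUnit (T + algebraMap ℂ A x) ∧ Ring.inverse (T + algebraMap ℂ A x) =
      (1 - δ * x - x ^ 2)⁻¹ • (T - algebraMap ℂ A (δ + x)) := by
  obtain ⟨h1, h2⟩ := add_mul_sub_of_quad hT x
  let u : Aˣ := ⟨T + algebraMap ℂ A x, (1 - δ * x - x ^ 2)⁻¹ • (T - algebraMap ℂ A (δ + x)),
    by rw [mul_smul_comm, h1, smul_smul, inv_mul_cancel₀ hx, one_smul],
    by rw [smul_mul_assoc, h2, smul_smul, inv_mul_cancel₀ hx, one_smul]⟩
  exact ⟨u.isUnit, Ring.inverse_unit u⟩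

theorem isUnit_T (i : Fin (n - 1)) : IsUnit (T q i) := by
  have := (inverse_of_quad (T_quad (q := q) i) (x := 0) (by simp)).1
  rwa [map_zero, add_zero] at this

theorem inverse_T (i : Fin (n - 1)) :
    Ring.inverse (T q i) = T q i - algebraMap ℂ _ (q - q⁻¹) := by
  have := (inverse_of_quad (T_quad (q := q) i) (x := 0) (by simp)).2
  simpa using this

theorem baxterQ_zero (i : Fin (n - 1)) (u v : ℂ) : baxterQ q i 0 u v = Ring.inverse (T q i) := by
  rw [inverse_T, baxterQ, zero_mul, zero_mul, zero_sub, div_neg, div_one, map_neg, ← sub_eq_add_neg]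

/-- For `t ≠ v` the norm vanishes only at `t = q^{±2} v`. -/
theorem one_sub_baxter (hq0 : q ≠ 0) {v t : ℂ} (hv : v ≠ 0) (htv : t ≠ v) :
    1 - (q - q⁻¹) * ((q - q⁻¹) / (t / v - 1)) - ((q - q⁻¹) / (t / v - 1)) ^ 2 =
      (t - q ^ 2 * v) * (t - (q ^ 2)⁻¹ * v) / (t - v) ^ 2 := by
  have h1 : t - v ≠ 0 := sub_ne_zero.mpr htv
  have h2 : t / v - 1 = (t - v) / v := by field_simp
  rw [h2]
  field_simp
  ring

theorem inverse_baxterT (hq0 : q ≠ 0) (i : Fin (n - 1)) {v t : ℂ} (hv : v ≠ 0) (htv : t ≠ v)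
    (h1 : t ≠ q ^ 2 * v) (h2 : t ≠ (q ^ 2)⁻¹ * v) :
    Ring.inverse (baxterT q i v t) =
      ((t - v) ^ 2 / ((t - q ^ 2 * v) * (t - (q ^ 2)⁻¹ * v))) • T q i +
      (-((q - q⁻¹) * t * (t - v)) / ((t - q ^ 2 * v) * (t - (q ^ 2)⁻¹ * v))) • 1 := by
  have h3 := sub_ne_zero.mpr htv
  have h4 := sub_ne_zero.mpr h1
  have h5 := sub_ne_zero.mpr h2
  have hb := one_sub_baxter hq0 hv htv
  rw [baxterT, (inverse_of_quad (T_quad i) (by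
    rw [hb]; exact div_ne_zero (mul_ne_zero h4 h5) (pow_ne_zero _ h3))).2, hb,
    Algebra.algebraMap_eq_smul_one, inv_div, smul_sub, smul_smul, sub_eq_add_neg, ← neg_smul]
  congr 2
  have h6 : t / v - 1 = (t - v) / v := by field_simp
  rw [h6]
  generalize t - q ^ 2 * v = x at *
  generalize t - (q ^ 2)⁻¹ * v = y at *
  generalize q - q⁻¹ = δ at *
  field_simp
  ring

theorem evaluatesTo_inverse_baxterT (hq0 : q ≠ 0) (i : Fin (n - 1)) {v a : ℂ} (hv : v ≠ 0)
    (hav : a ≠ v) (h1 : a ≠ q ^ 2 * v) (h2 : a ≠ (q ^ 2)⁻¹ * v) :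
    EvaluatesTo (fun t => Ring.inverse (baxterT q i v t)) a (Ring.inverse (baxterT q i v a)) := by
  let d : ℂ[X] := (X - C (q ^ 2 * v)) * (X - C ((q ^ 2)⁻¹ * v))
  have hd : d.eval a ≠ 0 := by
    simp only [d, eval_mul, eval_sub, eval_X, eval_C]
    exact mul_ne_zero (sub_ne_zero.mpr h1) (sub_ne_zero.mpr h2)
  have key := (evaluatesTo_div_smul ((X - C v) ^ 2) d hd (T q i)).add
    (evaluatesTo_div_smul (-(C (q - q⁻¹) * X * (X - C v))) d hd (1 : HeckeAlgebra n q))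
  simp only [d, eval_mul, eval_sub, eval_X, eval_C, eval_pow, eval_neg] at key
  rw [← inverse_baxterT hq0 i hv hav h1 h2] at key
  refine key.congr ?_
  filter_upwards [Filter.eventually_cofinite_ne v, Filter.eventually_cofinite_ne (q ^ 2 * v),
    Filter.eventually_cofinite_ne ((q ^ 2)⁻¹ * v)] with t ht1 ht2 ht3
  exact inverse_baxterT hq0 i hv ht1 ht2 ht3

theorem evaluatesTo_baxterQ (i : Fin (n - 1)) {c v a : ℂ} (h : c * a * v ≠ 1) :
    EvaluatesTo (fun t => baxterQ q i c t v) a (baxterQ q i c a v) := by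
  have key := (evaluatesTo_const (T q i) a).add (evaluatesTo_div_smul (C (q - q⁻¹))
    (C (c * v) * X - 1) (a := a) (by
      simp only [eval_sub, eval_mul, eval_C, eval_X, eval_one]
      intro h0
      exact h (by linear_combination h0)) (1 : HeckeAlgebra n q))
  simpa only [baxterQ, eval_sub, eval_mul, eval_C, eval_X, eval_one, ← Algebra.algebraMap_eq_smul_one,
    mul_right_comm c v] using key

/-- An earlier variable `u_k` enters the `j`-th factor through one `Q` and one inverse; the
hypotheses keep the generic `u_j` off the poles of both. -/
theorem evaluatesTo_fusionFactor (hq0 : q ≠ 0) (c : ℂ) {j k : Fin n} (hkj : k < j)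
    (u : Fin n → ℂ) {a : ℂ} (h0 : u j ≠ 0) (h1 : a ≠ u j) (h2 : a ≠ q ^ 2 * u j)
    (h3 : a ≠ (q ^ 2)⁻¹ * u j) (h4 : c * a * u j ≠ 1) :
    EvaluatesTo (fun t => fusionFactor q c (Function.update u k t) j) a
      (fusionFactor q c (Function.update u k a) j) := by
  simp only [fusionFactor, Function.update_of_ne hkj.ne']
  refine (evaluatesTo_descProd fun l => ?_).mul (evaluatesTo_ascProd fun l => ?_)
  · by_cases hl : varIndex j l = k
    · simp only [hl, Function.update_self]
      exact evaluatesTo_baxterQ _ h4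
    · simp only [Function.update_of_ne hl]
      exact evaluatesTo_const _ _
  · by_cases hl : varIndex j l = k
    · simp only [hl, Function.update_self]
      exact evaluatesTo_inverse_baxterT hq0 _ h0 h1 h2 h3
    · simp only [Function.update_of_ne hl]
      exact evaluatesTo_const _ _

end HeckeAlgebra

/-! ### The fusion recursion and consecutive evaluation. -/

namespace HeckeAlgebra

open StandardTableau

variable {n : ℕ} {q : ℂ}

/-- The elements have a joint eigenbasis in a faithful representation. -/
theorem jm_comm (hq : IsGenericUpTo n q) (hq0 : q ≠ 0) {j k : ℕ} (hj : j < n) (hk : k < n) :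
    Commute (jm n q j) (jm n q k) := by
  refine ext_of_totalRep hq hq0 fun S => ?_
  have h := isWeightVector_totalVec hq hq0 S
  rw [map_mul, map_mul, Module.End.mul_apply, Module.End.mul_apply, h j hj, h k hk, map_smul,
    map_smul, h j hj, h k hk, smul_comm]

theorem jm_mul_spectralProj (hq : IsGenericUpTo n q) (hq0 : q ≠ 0) {k : ℕ} (hk : k < n) {a : ℂ}
    (ha : a ∈ contentSet n q k) :
    jm n q k * spectralProj n q k a = a • spectralProj n q k a := by
  classical
  refine ext_of_totalRep hq hq0 fun S => ?_
  have h := isWeightVector_totalVec hq hq0 S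
  rw [map_mul, Module.End.mul_apply, map_smul, LinearMap.smul_apply, h.spectralProj_apply hk ha]
  split_ifs with hS
  · rw [h k hk, hS]
  · rw [map_zero, smul_zero]

theorem sum_spectralProj (hq : IsGenericUpTo n q) (hq0 : q ≠ 0) {k : ℕ} (hk : k < n) :
    ∑ a ∈ contentSet n q k, spectralProj n q k a = 1 := by
  classical
  refine ext_of_totalRep hq hq0 fun S => ?_
  have h := isWeightVector_totalVec hq hq0 S
  rw [map_sum, LinearMap.sum_apply, Finset.sum_congr rfl fun a ha => h.spectralProj_apply hk ha,
    Finset.sum_ite_eq, if_pos (contentAt_mem S k), map_one, Module.End.one_apply]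

theorem commute_aeval {A : Type*} [Ring A] [Algebra ℂ A] {x y : A} (h : Commute x y) (p : ℂ[X]) :
    Commute (aeval x p) y := by
  induction p using Polynomial.induction_on' with
  | add p r hp hr => rw [map_add]; exact hp.add_left hr
  | monomial m a =>
    rw [aeval_monomial]
    exact (Algebra.commute_algebraMap_left a y).mul_left (h.pow_left m)

theorem commute_spectralProj {k : ℕ} {y : HeckeAlgebra n q} (h : Commute (jm n q k) y) (a : ℂ) :
    Commute (spectralProj n q k a) y := commute_aeval h _

theorem commute_partialIdempotent (U : StandardTableau n) {k : ℕ} {y : HeckeAlgebra n q}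
    (h : ∀ i < k, Commute (jm n q i) y) : Commute (partialIdempotent q U k) y := by
  induction k with
  | zero => exact Commute.one_left y
  | succ k ih =>
    exact (ih fun i hi => h i (by omega)).mul_left
      (commute_spectralProj (h k (Nat.lt_succ_self k)) _)

theorem jm_comm_gen {i k : ℕ} (h : i < k) : Commute (jm n q i) (gen n q k) := by
  induction i with
  | zero => exact Commute.one_left _
  | succ i ih =>
    have h1 := gen_comm (n := n) (q := q) h
    exact (h1.mul_left (ih (by omega))).mul_left h1

/-- The spectral form of `(t - y_k)⁻¹`. -/
def resolvent (n : ℕ) (q : ℂ) (k : ℕ) (t : ℂ) : HeckeAlgebra n q :=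
  ∑ a ∈ contentSet n q k, (t - a)⁻¹ • spectralProj n q k a

theorem sub_mul_resolvent (hq : IsGenericUpTo n q) (hq0 : q ≠ 0) {k : ℕ} (hk : k < n) {t : ℂ}
    (ht : t ∉ contentSet n q k) : (t • 1 - jm n q k) * resolvent n q k t = 1 := by
  rw [resolvent, Finset.mul_sum]
  refine Eq.trans (Finset.sum_congr rfl fun a ha => ?_) (sum_spectralProj hq hq0 hk)
  have hta : t - a ≠ 0 := sub_ne_zero.mpr fun h => ht (h ▸ ha)
  rw [mul_smul_comm, sub_mul, smul_mul_assoc, one_mul, jm_mul_spectralProj hq hq0 hk ha, ← sub_smul,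
    smul_smul, inv_mul_cancel₀ hta, one_smul]

theorem commute_resolvent {k : ℕ} {y : HeckeAlgebra n q} (h : Commute (jm n q k) y) (t : ℂ) :
    Commute (resolvent n q k t) y :=
  Commute.sum_left _ _ _ fun a _ => (commute_spectralProj h a).smul_left _

theorem partialIdempotent_succ_mul_jm (hq : IsGenericUpTo n q) (hq0 : q ≠ 0)
    (U : StandardTableau n) {k : ℕ} (hk : k < n) : partialIdempotent q U (k + 1) * jm n q k =
      contentAt q U k • partialIdempotent q U (k + 1) := by
  rw [partialIdempotent, mul_assoc, (commute_spectralProj (Commute.refl _) _).eq,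
    jm_mul_spectralProj hq hq0 hk (contentAt_mem U k), mul_smul_comm]

/-- The exchange relation behind the recursion for the fusion factors. -/
theorem baxter_exchange {A : Type*} [Ring A] [Algebra ℂ A] {T y y' e : A} {δ a c t : ℂ}
    (hT : T * T = 1 + δ • T) (hy' : y' = T * y * T) (hey : e * y = a • e)
    (hyy' : Commute y' y) (hta : a ≠ t) (ht : t ≠ 0) (hct : c * a * t ≠ 1) :
    e * ((t • 1 - y') * ((T + algebraMap ℂ A (δ / (c * a * t - 1))) * ((c * t) • y - 1))) =
    e * (((c * t) • y' - 1) * ((T + algebraMap ℂ A (δ / (a / t - 1))) * (t • 1 - y))) := by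
  -- This is `T y = y' T⁻¹` with `T⁻¹ = T - δ`.
  have h1 : T * y = y' * T - δ • y' := by
    rw [hy', mul_assoc (T * y), hT]
    simp only [mul_add, mul_one, mul_smul_comm]
    abel
  have h2 : e * (y' * y) = a • (e * y') := by
    rw [hyy'.eq, ← mul_assoc, hey, smul_mul_assoc]
  have h3 : c * a * t - 1 ≠ 0 := sub_ne_zero.mpr hct
  have h4 : a - t ≠ 0 := sub_ne_zero.mpr hta
  have h5 : a / t - 1 = (a - t) / t := by field_simp
  rw [h5]
  -- Since `e` turns `y` into `a`, the spectral scalar `x` enters only through `x (cat - 1)` here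
  -- and `x (t - a)` in `e2`. The chosen scalars make these `δ` and `-δt`, and the two sides
  -- coincide.
  have e1 : ∀ x, e * ((t • 1 - y') * ((T + algebraMap ℂ A x) * ((c * t) • y - 1))) =
      e * ((t • 1 - y') * ((c * t) • (y' * T - δ • y') - T)) +
        (x * (c * a * t - 1)) • (e * (t • 1 - y')) := by
    intro x
    rw [← h1]
    simp only [Algebra.algebraMap_eq_smul_one, mul_add, add_mul, mul_sub, sub_mul, smul_mul_assoc,
      mul_smul_comm, mul_one, one_mul, h2, hey, smul_sub, smul_add]
    module
  have e2 : ∀ x, e * (((c * t) • y' - 1) * ((T + algebraMap ℂ A x) * (t • 1 - y))) =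
      e * (((c * t) • y' - 1) * (t • T - (y' * T - δ • y'))) +
        (x * (t - a)) • (e * ((c * t) • y' - 1)) := by
    intro x
    rw [← h1]
    simp only [Algebra.algebraMap_eq_smul_one, mul_add, add_mul, mul_sub, sub_mul, smul_mul_assoc,
      mul_smul_comm, mul_one, one_mul, h2, hey, smul_sub, smul_add]
    module
  have e3 : δ / ((a - t) / t) * (t - a) = -(δ * t) := by
    field_simp
    ring
  rw [e1, e2, div_mul_cancel₀ _ h3, e3]
  simp only [mul_sub, sub_mul, smul_mul_assoc, mul_smul_comm, mul_one, one_mul, smul_sub]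
  module

/-- The fusion factor for the contents of `U` and the spectral parameter `t`. -/
def partialFactor (q c : ℂ) (U : StandardTableau n) (t : ℂ) : ℕ → HeckeAlgebra n q
  | 0 => 1
  | k + 1 => (gen n q k + algebraMap ℂ _ ((q - q⁻¹) / (c * contentAt q U k * t - 1))) *
      partialFactor q c U t k *
      Ring.inverse (gen n q k + algebraMap ℂ _ ((q - q⁻¹) / (contentAt q U k / t - 1)))

/-- After the earlier evaluations the two ordered products nest: each step multiplies by one `Q` on
the left and one inverse on the right. -/
theorem fusionFactor_eq_partialFactor (c : ℂ) (U : StandardTableau n) (u : Fin n → ℂ) (j : Fin n)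
    (hu : ∀ i < j, u i = U.quantumContent q i) :
    fusionFactor q c u j = partialFactor q c U (u j) j.val := by
  have h : ∀ k : Fin j.val, u (varIndex j k) = contentAt q U k.val := by
    intro k
    rw [hu _ (Fin.lt_def.mpr k.isLt)]
    exact (contentAt_val U (varIndex j k)).symm
  simp only [fusionFactor, baxterQ, baxterT, T_genIndex, h]
  generalize u j = t
  clear h hu
  generalize j.val = m
  induction m with
  | zero => rw [ascProd_zero, descProd_zero, partialFactor, mul_one]
  | succ m ih =>
    rw [ascProd_succ, descProd_succ, partialFactor, ← ih]
    simp only [Fin.val_castSucc, Fin.val_last, mul_assoc]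

/-- The spectral parameter `t` avoids all poles and zeros that occur in the fusion procedure. -/
structure IsRegularParameter (q c : ℂ) (U : StandardTableau n) (t : ℂ) : Prop where
  ne_zero : t ≠ 0
  ne_one : t ≠ 1
  mul_ne_one : c * t ≠ 1
  notMem : ∀ k ∈ Finset.range n, t ∉ contentSet n q k
  mul_content_ne_one : ∀ k ∈ Finset.range n, c * contentAt q U k * t ≠ 1
  content_ne : ∀ k ∈ Finset.range n, contentAt q U k ≠ q ^ 2 * t
  content_ne' : ∀ k ∈ Finset.range n, contentAt q U k ≠ (q ^ 2)⁻¹ * t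

theorem eventually_mul_ne_one (x : ℂ) : ∀ᶠ t in Filter.cofinite, x * t ≠ 1 := by
  filter_upwards [Filter.eventually_cofinite_ne x⁻¹] with t ht h
  exact ht (eq_inv_of_mul_eq_one_right h)

theorem eventually_ne_mul {x : ℂ} (hx : x ≠ 0) (y : ℂ) :
    ∀ᶠ t in Filter.cofinite, y ≠ x * t := by
  filter_upwards [Filter.eventually_cofinite_ne (x⁻¹ * y)] with t ht h
  exact ht (by rw [h, inv_mul_cancel_left₀ hx])

theorem eventually_isRegularParameter (hq0 : q ≠ 0) (c : ℂ) (U : StandardTableau n) :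
    ∀ᶠ t in Filter.cofinite, IsRegularParameter q c U t := by
  have h1 : ∀ᶠ t in Filter.cofinite, ∀ k ∈ Finset.range n, t ∉ contentSet n q k :=
    (Filter.eventually_all_finset _).mpr fun k _ =>
      Filter.eventually_cofinite.mpr (by simp)
  have h2 : ∀ᶠ t in Filter.cofinite, ∀ k ∈ Finset.range n, c * contentAt q U k * t ≠ 1 :=
    (Filter.eventually_all_finset _).mpr fun k _ => eventually_mul_ne_one _
  have h3 : ∀ᶠ t in Filter.cofinite, ∀ k ∈ Finset.range n, contentAt q U k ≠ q ^ 2 * t :=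
    (Filter.eventually_all_finset _).mpr fun k _ => eventually_ne_mul (pow_ne_zero _ hq0) _
  have h4 : ∀ᶠ t in Filter.cofinite, ∀ k ∈ Finset.range n, contentAt q U k ≠ (q ^ 2)⁻¹ * t :=
    (Filter.eventually_all_finset _).mpr fun k _ =>
      eventually_ne_mul (inv_ne_zero (pow_ne_zero _ hq0)) _
  filter_upwards [Filter.eventually_cofinite_ne 0, Filter.eventually_cofinite_ne 1,
    eventually_mul_ne_one c, h1, h2, h3, h4] with t a b c d e f g
  exact ⟨a, b, c, d, e, f, g⟩

theorem IsRegularParameter.content_ne_self {c : ℂ} {U : StandardTableau n} {t : ℂ}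
    (ht : IsRegularParameter q c U t) {k : ℕ} (hk : k < n) : contentAt q U k ≠ t := fun h =>
  ht.notMem k (Finset.mem_range.mpr hk) (h ▸ contentAt_mem U k)

theorem IsRegularParameter.mul_inverse (hq0 : q ≠ 0) {c : ℂ} {U : StandardTableau n} {t : ℂ}
    (ht : IsRegularParameter q c U t) {k : ℕ} (hk : k + 1 < n) :
    (gen n q k + algebraMap ℂ _ ((q - q⁻¹) / (contentAt q U k / t - 1))) *
      Ring.inverse (gen n q k + algebraMap ℂ _ ((q - q⁻¹) / (contentAt q U k / t - 1))) = 1 := by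
  refine Ring.mul_inverse_cancel _ (inverse_of_quad (gen_quad hk) ?_).1
  have hkn := Finset.mem_range.mpr (show k < n by omega)
  have h1 := ht.content_ne_self (k := k) (by omega)
  rw [one_sub_baxter hq0 ht.ne_zero h1]
  exact div_ne_zero (mul_ne_zero (sub_ne_zero.mpr (ht.content_ne k hkn))
    (sub_ne_zero.mpr (ht.content_ne' k hkn))) (pow_ne_zero _ (sub_ne_zero.mpr h1))

/-- The heart of the fusion procedure. The next `Q` commutes with the projectors before the last
one, so the induction hypothesis can be inserted between it and the next inverse; `baxter_exchange`
then replaces the expression in `y` by the one in `y'`, and the baxterized factor cancels. -/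
theorem partialIdempotent_mul_partialFactor (hq : IsGenericUpTo n q) (hq0 : q ≠ 0) {c : ℂ}
    {U : StandardTableau n} {t : ℂ} (ht : IsRegularParameter q c U t) {k : ℕ} (hk : k < n) :
    partialIdempotent q U k * partialFactor q c U t k = ((t - 1) / (c * t - 1)) •
      (partialIdempotent q U k * (((c * t) • jm n q k - 1) * resolvent n q k t)) := by
  induction k with
  | zero =>
    have h1 := sub_mul_resolvent hq hq0 hk (ht.notMem 0 (Finset.mem_range.mpr hk))
    have h2 : t - 1 ≠ 0 := sub_ne_zero.mpr ht.ne_one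
    have h3 : c * t - 1 ≠ 0 := sub_ne_zero.mpr ht.mul_ne_one
    have h4 : ∀ x : ℂ, x • (1 : HeckeAlgebra n q) - 1 = (x - 1) • 1 := fun x => by module
    rw [jm, h4, smul_mul_assoc, one_mul] at h1
    rw [partialIdempotent, partialFactor, jm, h4, smul_mul_assoc, one_mul, one_mul, one_mul,
      smul_smul, div_mul_cancel₀ _ h3, h1]
  | succ k ih =>
    have hkn : k < n := by omega
    have hyy' := jm_comm hq hq0 hk hkn
    set e := partialIdempotent q U k
    set P := spectralProj n q k (contentAt q U k)
    set r := resolvent n q k t with hr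
    set r' := resolvent n q (k + 1) t with hr'
    set y := jm n q k
    set y' := jm n q (k + 1) with hy'
    set s := (t - 1) / (c * t - 1)
    set Q := gen n q k + algebraMap ℂ _ ((q - q⁻¹) / (c * contentAt q U k * t - 1)) with hQ
    set B := gen n q k + algebraMap ℂ _ ((q - q⁻¹) / (contentAt q U k / t - 1))
    have hBinv : B * Ring.inverse B = 1 := ht.mul_inverse hq0 hk
    have heQ : Commute e Q := Commute.add_right
      (commute_partialIdempotent U fun i hi => jm_comm_gen hi)
      (Algebra.commute_algebraMap_right _ _)
    have heP : e * P = P * e := (commute_partialIdempotent U fun i hi =>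
      (commute_spectralProj (jm_comm hq hq0 hkn (by omega)) _).symm).eq
    have hey' : Commute (e * P) y' := Commute.mul_left
      (commute_partialIdempotent U fun i hi => jm_comm hq hq0 (by omega) hk)
      (commute_spectralProj hyy'.symm _)
    have hsub : (t • 1 - y) * r = 1 :=
      sub_mul_resolvent hq hq0 hkn (ht.notMem k (Finset.mem_range.mpr hkn))
    have hry' : Commute r' y' := commute_resolvent (Commute.refl _) t
    have hr1 : r' * (t • 1 - y') = 1 := by
      have : Commute r' (t • 1 - y') := ((Commute.one_right r').smul_right t).sub_right hry'
      rw [this.eq]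
      exact sub_mul_resolvent hq hq0 hk (ht.notMem (k + 1) (Finset.mem_range.mpr hk))
    have her' : Commute r' (e * P) := commute_resolvent hey'.symm t
    have hkey := baxter_exchange (δ := q - q⁻¹) (gen_quad hk) (show y' = _ from rfl)
      (partialIdempotent_succ_mul_jm hq hq0 U hkn) hyy' (ht.content_ne_self hkn) ht.ne_zero
      (ht.mul_content_ne_one k (Finset.mem_range.mpr hkn))
    change (e * P) * ((t • 1 - y') * (Q * ((c * t) • y - 1))) =
      (e * P) * (((c * t) • y' - 1) * (B * (t • 1 - y))) at hkey
    -- Divide the exchange relation by `t - y'`, whose inverse `r'` commutes with the projectors.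
    have hkey' : (e * P) * (Q * ((c * t) • y - 1)) =
        r' * ((e * P) * (((c * t) • y' - 1) * (B * (t • 1 - y)))) := by
      rw [← hkey, ← mul_assoc r', her'.eq, mul_assoc (e * P) r', ← mul_assoc r', hr1, one_mul]
    have hr'2 : Commute r' ((c * t) • y' - 1) :=
      (hry'.smul_right _).sub_right (Commute.one_right _)
    calc (e * P) * (Q * partialFactor q c U t k * Ring.inverse B)
        = P * Q * (e * partialFactor q c U t k) * Ring.inverse B := by
          rw [heP]
          simp only [mul_assoc]
          rw [← mul_assoc e Q, heQ.eq, mul_assoc]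
      _ = s • (P * Q * (e * (((c * t) • y - 1) * r)) * Ring.inverse B) := by
          rw [ih hkn, mul_smul_comm, smul_mul_assoc]
      _ = s • ((e * P) * (Q * ((c * t) • y - 1)) * (r * Ring.inverse B)) := by
          rw [heP]
          simp only [mul_assoc]
          rw [← mul_assoc Q e, ← heQ.eq, mul_assoc]
      _ = s • (r' * ((e * P) * ((c * t) • y' - 1))) := by
          rw [hkey']
          simp only [mul_assoc]
          rw [← mul_assoc (t • 1 - y) r, hsub, one_mul, hBinv, mul_one]
      _ = s • ((e * P) * (((c * t) • y' - 1) * r')) := by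
          rw [← mul_assoc, her'.eq, mul_assoc, hr'2.eq]

theorem mul_resolvent_eq_sum (hq : IsGenericUpTo n q) (hq0 : q ≠ 0) {k : ℕ} (hk : k < n)
    (x t : ℂ) : (x • jm n q k - 1) * resolvent n q k t =
      ∑ b ∈ contentSet n q k, ((x * b - 1) / (t - b)) • spectralProj n q k b := by
  rw [resolvent, Finset.mul_sum]
  refine Finset.sum_congr rfl fun b hb => ?_
  rw [mul_smul_comm, sub_mul, smul_mul_assoc, one_mul, jm_mul_spectralProj hq hq0 hk hb]
  module

/-- The scalar multiple of a fusion factor which enters the fusion function. -/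
def normalizedFactor (q c : ℂ) (U : StandardTableau n) (j : Fin n) (u : Fin n → ℂ) :
    HeckeAlgebra n q :=
  ((u j - U.quantumContent q j) / (c * u j * U.quantumContent q j - 1) *
    ((c * u j - 1) / (u j - 1))) • fusionFactor q c u j

theorem ascProd_smul {A : Type*} [Ring A] [Algebra ℂ A] {j : ℕ} (s : Fin j → ℂ) (f : Fin j → A) :
    ascProd (fun k => s k • f k) = (∏ k, s k) • ascProd f := by
  induction j with
  | zero => simp [ascProd_zero]
  | succ j ih => rw [ascProd_succ, ih, ascProd_succ f, Fin.prod_univ_castSucc, smul_mul_smul_comm]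

theorem fusionFunction_eq (c : ℂ) (U : StandardTableau n) :
    fusionFunction q c U = fun u => partialIdempotent q U 0 *
      ascProd (fun j => normalizedFactor q c U j u) := by
  ext u
  simp only [fusionFunction, normalizedFactor, partialIdempotent, one_mul]
  rw [ascProd_smul]

/-- Among the spectral components only `b = a` survives: the zero of `t - a` is cancelled there by
the pole of the resolvent and nowhere else. -/
theorem evaluatesTo_partialIdempotent_mul (hq : IsGenericUpTo n q) (hq0 : q ≠ 0) {c : ℂ}
    (U : StandardTableau n) (k : Fin n) (hc : c * U.quantumContent q k ^ 2 ≠ 1) (u : Fin n → ℂ)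
    (hu : ∀ i < k, u i = U.quantumContent q i) :
    EvaluatesTo (fun t => partialIdempotent q U k.val *
      normalizedFactor q c U k (Function.update u k t)) (U.quantumContent q k)
      (partialIdempotent q U (k.val + 1)) := by
  classical
  set a := U.quantumContent q k with ha
  have hka : contentAt q U k.val = a := contentAt_val U k
  set e := partialIdempotent q U k.val
  -- The condition on `c` keeps the denominator `cta - 1` nonzero at `t = a`.
  have hc' : c * a * a - 1 ≠ 0 := by
    rw [sub_ne_zero]
    intro h
    exact hc (by rw [sq, ← mul_assoc]; exact h)
  have hsum : EvaluatesTo (fun t => ∑ b ∈ contentSet n q k.val,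
      ((t - a) / (c * t * a - 1) * ((c * t * b - 1) / (t - b))) • (e * spectralProj n q k.val b)) a
      (∑ b ∈ contentSet n q k.val, if b = a then e * spectralProj n q k.val b else 0) := by
    refine evaluatesTo_sum _ fun b _ => ?_
    split_ifs with hb
    · rw [hb]
      refine (evaluatesTo_const _ _).congr ?_
      filter_upwards [Filter.eventually_cofinite_ne a, eventually_mul_ne_one (c * a)] with t h1 h2
      have h3 : t - a ≠ 0 := sub_ne_zero.mpr h1
      have h4 : c * t * a - 1 ≠ 0 := sub_ne_zero.mpr (by rwa [mul_right_comm])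
      have h5 : (t - a) / (c * t * a - 1) * ((c * t * a - 1) / (t - a)) = 1 := by
        rw [div_mul_div_cancel₀ h4, div_self h3]
      rw [h5, one_smul]
    · have h1 : a - b ≠ 0 := sub_ne_zero.mpr (Ne.symm hb)
      have := evaluatesTo_div_smul ((X - C a) * (C (c * b) * X - 1))
        ((C (c * a) * X - 1) * (X - C b)) (a := a) (by
          simp only [eval_sub, eval_mul, eval_C, eval_X, eval_one]
          exact mul_ne_zero hc' h1) (e * spectralProj n q k.val b)
      simp only [eval_sub, eval_mul, eval_C, eval_X, eval_one, sub_self, zero_mul, zero_div,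
        zero_smul] at this
      refine this.congr (Filter.Eventually.of_forall fun t => ?_)
      rw [div_mul_div_comm, mul_right_comm c t b, mul_right_comm c t a]
  rw [Finset.sum_ite_eq', if_pos (hka ▸ contentAt_mem U k.val)] at hsum
  have he : partialIdempotent q U (k.val + 1) = e * spectralProj n q k.val a := by
    rw [partialIdempotent, hka]
  rw [he]
  refine hsum.congr ?_
  filter_upwards [eventually_isRegularParameter hq0 c U] with t ht
  have h2 : t - 1 ≠ 0 := sub_ne_zero.mpr ht.ne_one
  have h3 : c * t - 1 ≠ 0 := sub_ne_zero.mpr ht.mul_ne_one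
  rw [normalizedFactor, Function.update_self, fusionFactor_eq_partialFactor c U _ k (by
    intro i hi
    rw [Function.update_of_ne hi.ne]
    exact hu i hi), Function.update_self, mul_smul_comm,
    partialIdempotent_mul_partialFactor hq hq0 ht k.isLt, mul_resolvent_eq_sum hq hq0 k.isLt,
    smul_smul, Finset.mul_sum, Finset.smul_sum]
  refine Finset.sum_congr rfl fun b _ => ?_
  rw [mul_smul_comm, smul_smul]
  congr 1
  have h4 : (c * t - 1) / (t - 1) * ((t - 1) / (c * t - 1)) = 1 := by
    field_simp
  rw [mul_assoc (_ / _), h4, mul_one]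

theorem consecutivelyEvaluatesTo_fusionFunction (hq : IsGenericUpTo n q) (hq0 : q ≠ 0)
    (U : StandardTableau n) {c : ℂ} (hc : ∀ k : Fin n, c * U.quantumContent q k ^ 2 ≠ 1) :
    ConsecutivelyEvaluatesTo (fusionFunction q c U) (U.quantumContent q)
      (tableauIdempotent q U) := by
  classical
  rw [fusionFunction_eq]
  -- The values of a later variable at which its factor may be singular when the `k`-th variable is
  -- the `k`-th content. For `c = 0` the last entry is `0`, which is excluded anyway.
  let B : Finset ℂ := insert 0 (Finset.univ.biUnion fun k : Fin n =>
    {U.quantumContent q k, q ^ 2 * U.quantumContent q k, (q ^ 2)⁻¹ * U.quantumContent q k,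
      (c * U.quantumContent q k)⁻¹})
  refine consecutivelyEvaluatesTo_ascProd (fun j u => normalizedFactor q c U j u)
    (U.quantumContent q) (partialIdempotent q U) B ?_ ?_
  · intro k j hkj u _ hu
    have hB : u j ≠ 0 ∧ u j ≠ U.quantumContent q k ∧ u j ≠ q ^ 2 * U.quantumContent q k ∧
        u j ≠ (q ^ 2)⁻¹ * U.quantumContent q k ∧ u j ≠ (c * U.quantumContent q k)⁻¹ := by
      have hj := hu j hkj
      simp only [B, Finset.mem_insert, Finset.mem_biUnion, Finset.mem_univ, true_and,
        Finset.mem_singleton, not_or, not_exists] at hj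
      exact ⟨hj.1, hj.2 k⟩
    obtain ⟨h0, h1, h2, h3, h4⟩ := hB
    have hq2 : q ^ 2 ≠ 0 := pow_ne_zero _ hq0
    simp only [normalizedFactor, Function.update_of_ne hkj.ne']
    have key := evaluatesTo_fusionFactor hq0 c hkj u (a := U.quantumContent q k) h0 h1.symm
      (fun h => h3 (by rw [h, inv_mul_cancel_left₀ hq2]))
      (fun h => h2 (by rw [h, mul_inv_cancel_left₀ hq2]))
      (fun h => h4 (eq_inv_of_mul_eq_one_right h))
    simpa only [← Algebra.smul_def] using (evaluatesTo_const (algebraMap ℂ (HeckeAlgebra n q)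
      ((u j - U.quantumContent q j) / (c * u j * U.quantumContent q j - 1) *
        ((c * u j - 1) / (u j - 1)))) (U.quantumContent q k)).mul key
  · exact fun k u hu => evaluatesTo_partialIdempotent_mul hq hq0 U k (hc k) u hu

theorem fusionFunction_zero (U : StandardTableau n) :
    fusionFunction q 0 U = plainFusionFunction q U := by
  ext u
  rw [fusionFunction, plainFusionFunction]
  congr 1
  · refine Finset.prod_congr rfl fun k _ => ?_
    -- At `c = 0` the denominator `c u_k c_k - 1` and the numerator `c u_k - 1` are both `-1`, and
    -- the signs cancel.
    rw [zero_mul, zero_mul, zero_sub, div_neg, div_one, neg_mul, neg_div, mul_neg, neg_neg,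
      mul_one_div]
  · simp only [fusionFactor, baxterQ_zero]

end HeckeAlgebra
end

theorem mainTheorem2 (n : ℕ) (q : ℂ) (hq0 : q ≠ 0)
    (hq : ∀ k : ℕ, 1 ≤ k → k ≤ n → q ^ (2 * k) ≠ 1) :
    (∀ U : StandardTableau n,
      ∃ e : HeckeAlgebra n q,
        (IsTableauIdempotent q U e ∧
          ∀ e' : HeckeAlgebra n q, IsTableauIdempotent q U e' → e' = e) ∧
        IsPrimitiveIdempotent e ∧
        (∀ c : ℂ, (∀ k : Fin n, c * U.quantumContent q k ^ 2 ≠ 1) →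
          ConsecutivelyEvaluatesTo (HeckeAlgebra.fusionFunction q c U)
            (U.quantumContent q) e) ∧
        ConsecutivelyEvaluatesTo (HeckeAlgebra.plainFusionFunction q U)
          (U.quantumContent q) e ∧
        HeckeAlgebra.fusionFunction q 0 U = HeckeAlgebra.plainFusionFunction q U) ∧
    (∀ (i : Fin (n - 1)) (u v : ℂ), IsUnit (HeckeAlgebra.T q i) ∧
      HeckeAlgebra.baxterQ q i 0 u v = Ring.inverse (HeckeAlgebra.T q i)) := by
  refine ⟨fun U => ⟨HeckeAlgebra.tableauIdempotent q U,
    ⟨HeckeAlgebra.isTableauIdempotent_tableauIdempotent hq hq0 U,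
      fun e' he' => HeckeAlgebra.eq_tableauIdempotent hq hq0 U he'⟩,
    HeckeAlgebra.isPrimitiveIdempotent_tableauIdempotent hq hq0 U,
    fun c hc => HeckeAlgebra.consecutivelyEvaluatesTo_fusionFunction hq hq0 U hc, ?_,
    HeckeAlgebra.fusionFunction_zero U⟩,
    fun i u v => ⟨HeckeAlgebra.isUnit_T i, HeckeAlgebra.baxterQ_zero i u v⟩⟩
  rw [← HeckeAlgebra.fusionFunction_zero]
  exact HeckeAlgebra.consecutivelyEvaluatesTo_fusionFunction hq hq0 U fun k => by
    rw [zero_mul]; exact zero_ne_one
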